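/- For integers $n, d \ge 1$, a function $f : \{-1,1\}^n \to \{-1,1\}$ is called a polynomial threshold function of degree $d$ if there is a real polynomial $p$ in $n$ variables, of total degree at most $d$ and with no roots in $\{-1,1\}^n$, such that $f(x) = \operatorname{sgn}(p(x))$ for all $x \in \{-1,1\}^n$. Let $T(n,d)$ denote the number of such functions $f$. (1) There is an absolute constant $C > 0$ such that for all integers $n$ and $d$ with $n > 1$ and $1 \le d \le n^{0.9}$, $$ \Big( 1 - \frac{C}{\log n} \Big)_+^d \cdot \frac{n^{d+1}}{d!} < \log_2 T(n,d) < \frac{n^{d+1}}{d!}, $$ where $\log$ is the natural logarithm and $t_+ = \max(t, 0)$. (2) For all integers $n > 1$ and $1 \le d \le n$ one has $\log_2 T(n,d) \le n^{d+1}/d!$, and the inequality is strict unless $n = d = 2$. -/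

import Mathlib

/-- The `{-1, 1}`-valued Boolean function `f` on the cube `{-1, 1}ⁿ` is a polynomial threshold
function of degree (at most) `d`: it is the sign of some real polynomial in `n` variables of total
degree at most `d` that has no roots in the cube. The set `{-1, 1}` is represented by `ℤˣ`. -/
def IsPolynomialThreshold (n d : ℕ) (f : (Fin n → ℤˣ) → ℤˣ) : Prop :=
  ∃ p : MvPolynomial (Fin n) ℝ, p.totalDegree ≤ d ∧
    ∀ x : Fin n → ℤˣ,
      MvPolynomial.eval (fun i => (((x i : ℤˣ) : ℤ) : ℝ)) p ≠ 0 ∧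
      (((f x : ℤˣ) : ℤ) : ℝ) =
        Real.sign (MvPolynomial.eval (fun i => (((x i : ℤˣ) : ℤ) : ℝ)) p)

/-- `T(n, d)`: the number of polynomial threshold functions of degree `d` in `n` variables. (All
`{-1, 1}`-valued functions on the cube form a finite type, so `Nat.card` is a genuine count.) -/
noncomputable def numPTF (n d : ℕ) : ℕ :=
  Nat.card {f : (Fin n → ℤˣ) → ℤˣ // IsPolynomialThreshold n d f}

/-!
Threshold functions of degree `d` are the sign patterns, without zeros, of the space `Q` of
multilinear polynomials of degree at most `d`, whose dimension is `N = ∑ i ≤ d, n.choose i`.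

*Upper bound.* A set of points of the cube that is shattered by these sign patterns has at most `N`
elements, so `T(n, d) ≤ ∑ i ≤ N, (2 ^ n).choose i ≤ (e * 2 ^ n / N) ^ N` by Sauer–Shelah. Here `N`
may exceed `n ^ d / d!` by a little, but the gain from the factor `(e / N) ^ N` outweighs this. For
`d ≥ n - 1` the trivial bound `T(n, d) ≤ 2 ^ 2 ^ n` suffices.

*Lower bound.* By deletion and restriction, there are at least as many sign patterns as flats, the
zero sets of members of `Q`. Split the coordinates into `m + 1` and `n₂`, and let
`k ≤ ∑ i ≤ d, m.choose i`. A subspace containing the evaluation vectors of `2 ^ m` points of a cube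
has dimension at least `∑ i ≤ d, m.choose i`; hence at least `2 ^ (m * k)` of the `k`-tuples of
points of the first cube have linearly independent evaluation vectors. If `n₂` further columns are
appended to such a tuple, the Littlewood–Offord inequality shows that, for at least half of the
choices, every point of the flat spanned by the tuple is a combination of fewer than `s` of its
points. There are at most `M = k ^ s * 2 ^ s * 2 ^ n₂` such points, so a flat arises from at most
`M ^ k` tuples, and `2 ^ ((m + n₂) * k) ≤ 2 * M ^ k * T(n, d)`. For `d ≤ n ^ α` with `α < 1`, take
`s ≈ n ^ β` with `β = (1 - α) / 2`, `n₂ ≈ (4 / β) * n / log n` and `k = m.choose d`.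
-/

namespace PTF

open Filter Finset Module
open scoped Topology

/-! ### Zero sets and sign patterns of a space of functions -/

section SignPatterns

variable {X : Type*} {Q : Submodule ℝ (X → ℝ)} {A : Finset X} {x : X}
  {p q : X → ℝ}

open Classical in
/-- The traces on `A` of the zero sets of the members of `Q`: the flats of the central hyperplane
arrangement that the points of `A` cut out in `Q`. -/
noncomputable def zeroSets (Q : Submodule ℝ (X → ℝ)) (A : Finset X) : Finset (Finset X) :=
  {Z ∈ A.powerset | ∃ p ∈ Q, {y ∈ A | p y = 0} = Z}

/-- `p` vanishes at a point of `A` only if every member of `Q` does; for `p ∈ Q` this says that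
`p` lies on none of the hyperplanes that the points of `A` cut out in `Q`. -/
def IsGeneric (Q : Submodule ℝ (X → ℝ)) (A : Finset X) (p : X → ℝ) : Prop :=
  ∀ y ∈ A, p y = 0 → ∀ q ∈ Q, q y = 0

open Classical in
/-- The traces on `A` of the positivity sets of the generic members of `Q`: the chambers of the
hyperplane arrangement that the points of `A` cut out in `Q`. -/
noncomputable def posSets (Q : Submodule ℝ (X → ℝ)) (A : Finset X) : Finset (Finset X) :=
  {P ∈ A.powerset | ∃ p ∈ Q, IsGeneric Q A p ∧ {y ∈ A | 0 < p y} = P}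

/-- The members of `Q` that vanish at `x`. -/
def vanishingAt (Q : Submodule ℝ (X → ℝ)) (x : X) : Submodule ℝ (X → ℝ) :=
  Q ⊓ LinearMap.ker (LinearMap.proj x : (X → ℝ) →ₗ[ℝ] ℝ)

lemma mem_zeroSets {Z : Finset X} : Z ∈ zeroSets Q A ↔ ∃ p ∈ Q, {y ∈ A | p y = 0} = Z := by
  classical
  simp only [zeroSets, mem_filter, mem_powerset, and_iff_right_iff_imp]
  rintro ⟨p, -, rfl⟩
  exact filter_subset _ _

lemma mem_posSets {P : Finset X} :
    P ∈ posSets Q A ↔ ∃ p ∈ Q, IsGeneric Q A p ∧ {y ∈ A | 0 < p y} = P := by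
  classical
  simp only [posSets, mem_filter, mem_powerset, and_iff_right_iff_imp]
  rintro ⟨p, -, -, rfl⟩
  exact filter_subset _ _

lemma mem_vanishingAt : p ∈ vanishingAt Q x ↔ p ∈ Q ∧ p x = 0 := by
  simp [vanishingAt]

lemma IsGeneric.eventually_add_smul {g : X → ℝ} (hp : IsGeneric Q A p) (hg : g ∈ Q) :
    ∀ᶠ ε in 𝓝 (0 : ℝ), IsGeneric Q A (p + ε • g) ∧
      ({y ∈ A | 0 < (p + ε • g) y} : Finset X) = {y ∈ A | 0 < p y} := by
  have hsign : ∀ᶠ ε in 𝓝 (0 : ℝ), ∀ y ∈ A,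
      SignType.sign (p y + ε * g y) = SignType.sign (p y) := by
    rw [eventually_all_finset]
    intro y hy
    rcases eq_or_ne (p y) 0 with h0 | h0
    · simp [hp y hy h0 g hg]
    have hlim : Tendsto (fun ε : ℝ ↦ p y + ε * g y) (𝓝 0) (𝓝 (p y)) := by
      simpa using (by fun_prop : Continuous fun ε : ℝ ↦ p y + ε * g y).tendsto 0
    have hsignlim := (continuousAt_sign_of_ne_zero h0).tendsto.comp hlim
    rwa [nhds_discrete SignType, tendsto_pure] at hsignlim
  filter_upwards [hsign] with ε hε
  refine ⟨fun y hy h0 ↦ hp y hy ?_, filter_congr fun y hy ↦ ?_⟩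
  · rw [← sign_eq_zero_iff, ← hε y hy, sign_eq_zero_iff]
    exact h0
  · rw [← sign_eq_one_iff (a := p y), ← hε y hy, sign_eq_one_iff]
    rfl

lemma eq_zero_of_forall_vanishingAt {y : X} (hy : ∀ q ∈ vanishingAt Q x, q y = 0)
    (hpQ : p ∈ Q) (hpy : p y ≠ 0) (hqQ : q ∈ Q) (hqy : q y = 0) : q x = 0 := by
  have hmem : p x • q - q x • p ∈ vanishingAt Q x :=
    mem_vanishingAt.2 ⟨Q.sub_mem (Q.smul_mem _ hqQ) (Q.smul_mem _ hpQ), by simp [mul_comm]⟩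
  simpa [hqy, hpy] using hy _ hmem

variable [DecidableEq X]

lemma IsGeneric.insert_of_imp (hp : IsGeneric Q A p) (hx : p x = 0 → ∀ q ∈ Q, q x = 0) :
    IsGeneric Q (insert x A) p :=
  forall_mem_insert .. |>.2 ⟨hx, hp⟩

lemma IsGeneric.exists_insert (hpQ : p ∈ Q) (hp : IsGeneric Q A p) :
    ∃ p' ∈ Q, IsGeneric Q (insert x A) p' ∧
      ({y ∈ A | 0 < p' y} : Finset X) = {y ∈ A | 0 < p y} := by
  by_cases hx : p x = 0 → ∀ q ∈ Q, q x = 0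
  · exact ⟨p, hpQ, hp.insert_of_imp hx, rfl⟩
  push Not at hx
  obtain ⟨hpx, g, hg, hgx⟩ := hx
  obtain ⟨ε, ⟨hgen, hpos⟩, hε⟩ := (((hp.eventually_add_smul hg).filter_mono nhdsWithin_le_nhds).and
    (self_mem_nhdsWithin : ({0}ᶜ : Set ℝ) ∈ 𝓝[≠] 0)).exists
  refine ⟨p + ε • g, Q.add_mem hpQ (Q.smul_mem ε hg), hgen.insert_of_imp fun h ↦ ?_, hpos⟩
  simp_all

omit [DecidableEq X] in
lemma exists_isGeneric (Q : Submodule ℝ (X → ℝ)) (A : Finset X) : ∃ p ∈ Q, IsGeneric Q A p := by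
  classical
  induction A using Finset.induction with
  | empty => exact ⟨0, Q.zero_mem, by simp [IsGeneric]⟩
  | insert x A _ ih =>
    obtain ⟨p, hpQ, hp⟩ := ih
    obtain ⟨p', hp'Q, hp', -⟩ := hp.exists_insert (x := x) hpQ
    exact ⟨p', hp'Q, hp'⟩

lemma IsGeneric.mem_posSets_insert_of_mem_vanishingAt {g : X → ℝ} (hg : g ∈ Q)
    (hgx : g x = 1) (hloop : ∀ y ∈ A, (∀ q ∈ vanishingAt Q x, q y = 0) → ∀ q ∈ Q, q y = 0)
    (hpV : p ∈ vanishingAt Q x) (hp : IsGeneric (vanishingAt Q x) A p) :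
    ({y ∈ A | 0 < p y} : Finset X) ∈ posSets Q (insert x A) ∧
      insert x ({y ∈ A | 0 < p y} : Finset X) ∈ posSets Q (insert x A) := by
  obtain ⟨hpQ, hpx⟩ := mem_vanishingAt.1 hpV
  have hpgen : IsGeneric Q A p := fun y hy h0 ↦ hloop y hy (hp y hy h0)
  have hev := hpgen.eventually_add_smul hg
  have hval (ε : ℝ) : (p + ε • g) x = ε := by simp [hpx, hgx]
  obtain ⟨δ, ⟨hδgen, hδpos⟩, hδ⟩ := ((hev.filter_mono nhdsWithin_le_nhds).and
    (self_mem_nhdsWithin : Set.Iio (0 : ℝ) ∈ 𝓝[<] 0)).exists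
  obtain ⟨ε, ⟨hεgen, hεpos⟩, hε⟩ := ((hev.filter_mono nhdsWithin_le_nhds).and
    (self_mem_nhdsWithin : Set.Ioi (0 : ℝ) ∈ 𝓝[>] 0)).exists
  replace hδ : δ < 0 := hδ
  replace hε : 0 < ε := hε
  constructor <;> rw [mem_posSets]
  · refine ⟨p + δ • g, Q.add_mem hpQ (Q.smul_mem δ hg), hδgen.insert_of_imp fun h ↦ ?_, ?_⟩
    · exact absurd ((hval δ).symm.trans h) hδ.ne
    · rw [filter_insert, hval, if_neg hδ.not_gt, hδpos]
  · refine ⟨p + ε • g, Q.add_mem hpQ (Q.smul_mem ε hg), hεgen.insert_of_imp fun h ↦ ?_, ?_⟩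
    · exact absurd ((hval ε).symm.trans h) hε.ne'
    · rw [filter_insert, hval, if_pos hε, hεpos]

lemma posSets_subset_image_erase (hx : x ∉ A) :
    posSets Q A ⊆ (posSets Q (insert x A)).image fun P ↦ P.erase x := by
  intro P hP
  obtain ⟨p, hpQ, hp, rfl⟩ := mem_posSets.1 hP
  obtain ⟨p', hp'Q, hp', hpos⟩ := hp.exists_insert (x := x) hpQ
  refine mem_image.2 ⟨_, mem_posSets.2 ⟨p', hp'Q, hp', rfl⟩, ?_⟩
  rw [← hpos, ← filter_erase, erase_insert hx]

lemma card_posSets_le_card_posSets_insert (hx : x ∉ A) :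
    #(posSets Q A) ≤ #(posSets Q (insert x A)) :=
  (card_le_card (posSets_subset_image_erase hx)).trans card_image_le

lemma card_posSets_add_card_posSets_le {g : X → ℝ} (hx : x ∉ A) (hg : g ∈ Q) (hgx : g x = 1)
    (hloop : ∀ y ∈ A, (∀ q ∈ vanishingAt Q x, q y = 0) → ∀ q ∈ Q, q y = 0) :
    #(posSets Q A) + #(posSets (vanishingAt Q x) A) ≤ #(posSets Q (insert x A)) := by
  rw [← card_memberSubfamily_add_card_nonMemberSubfamily x (posSets Q (insert x A)),
    ← card_union_add_card_inter (memberSubfamily x _)]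
  refine add_le_add (card_le_card ?_) (card_le_card fun P hP ↦ ?_)
  · rw [memberSubfamily_union_nonMemberSubfamily]
    exact posSets_subset_image_erase hx
  · obtain ⟨p, hpV, hp, rfl⟩ := mem_posSets.1 hP
    have hmem := hp.mem_posSets_insert_of_mem_vanishingAt hg hgx hloop hpV
    have hxP : x ∉ ({y ∈ A | 0 < p y} : Finset X) := fun h ↦ hx (mem_filter.1 h).1
    exact mem_inter.2
      ⟨mem_memberSubfamily.2 ⟨hmem.2, hxP⟩, mem_nonMemberSubfamily.2 ⟨hmem.1, hxP⟩⟩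

lemma card_zeroSets_insert_le (hx : x ∉ A) :
    #(zeroSets Q (insert x A)) ≤ #(zeroSets Q A) + #(zeroSets (vanishingAt Q x) A) := by
  rw [← card_memberSubfamily_add_card_nonMemberSubfamily x, add_comm]
  refine add_le_add (card_le_card fun Z hZ ↦ ?_) (card_le_card fun Z hZ ↦ ?_)
  · obtain ⟨hZ, hxZ⟩ := mem_nonMemberSubfamily.1 hZ
    obtain ⟨p, hpQ, rfl⟩ := mem_zeroSets.1 hZ
    refine mem_zeroSets.2 ⟨p, hpQ, ?_⟩
    rw [← erase_eq_of_notMem hxZ, ← filter_erase, erase_insert hx]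
  · obtain ⟨hZ, hxZ⟩ := mem_memberSubfamily.1 hZ
    obtain ⟨p, hpQ, hpZ⟩ := mem_zeroSets.1 hZ
    have hpx : p x = 0 := (mem_filter.1 (hpZ.symm ▸ mem_insert_self x Z :)).2
    refine mem_zeroSets.2 ⟨p, mem_vanishingAt.2 ⟨hpQ, hpx⟩, ?_⟩
    rw [← erase_insert hx, filter_erase, hpZ, erase_insert hxZ]

lemma card_zeroSets_insert_le_of_zero_iff (hx : x ∉ A)
    (hzero : ∀ p ∈ Q, ∀ q ∈ Q, (∀ y ∈ A, p y = 0 ↔ q y = 0) → (p x = 0 ↔ q x = 0)) :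
    #(zeroSets Q (insert x A)) ≤ #(zeroSets Q A) := by
  have htrace (p : X → ℝ) :
      ({y ∈ insert x A | p y = 0} : Finset X).erase x = {y ∈ A | p y = 0} := by
    rw [← filter_erase, erase_insert hx]
  refine card_le_card_of_injOn (fun Z ↦ Z.erase x) (fun Z hZ ↦ ?_) fun Z hZ W hW hZW ↦ ?_
  · obtain ⟨p, hpQ, rfl⟩ := mem_zeroSets.1 hZ
    exact mem_zeroSets.2 ⟨p, hpQ, (htrace p).symm⟩
  · obtain ⟨p, hpQ, rfl⟩ := mem_zeroSets.1 hZ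
    obtain ⟨q, hqQ, rfl⟩ := mem_zeroSets.1 hW
    simp only [htrace, filter_inj'] at hZW
    have hA : ∀ y ∈ A, p y = 0 ↔ q y = 0 := fun y hy ↦ hZW hy
    exact filter_congr (forall_mem_insert .. |>.2 ⟨hzero p hpQ q hqQ hA, hA⟩)

omit [DecidableEq X] in
/-- Deletion and restriction: the number of zero sets is subadditive, while the number of sign
patterns is superadditive. -/
theorem card_zeroSets_le_card_posSets (Q : Submodule ℝ (X → ℝ)) (A : Finset X) :
    #(zeroSets Q A) ≤ #(posSets Q A) := by
  classical
  induction A using Finset.induction generalizing Q with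
  | empty =>
    refine (card_le_card (t := {∅}) fun Z hZ ↦ ?_).trans
      (card_pos.2 ⟨∅, mem_posSets.2 ⟨0, Q.zero_mem, by simp [IsGeneric], by simp⟩⟩)
    obtain ⟨p, -, rfl⟩ := mem_zeroSets.1 hZ
    simp
  | insert x A hx ih =>
    by_cases hxQ : ∀ q ∈ Q, q x = 0
    · exact (card_zeroSets_insert_le_of_zero_iff hx fun p hp q hq _ ↦
        iff_of_true (hxQ p hp) (hxQ q hq)).trans
          ((ih Q).trans (card_posSets_le_card_posSets_insert hx))
    by_cases hloop : ∀ y ∈ A, (∀ q ∈ vanishingAt Q x, q y = 0) → ∀ q ∈ Q, q y = 0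
    · push Not at hxQ
      obtain ⟨g, hg, hgx⟩ := hxQ
      exact (card_zeroSets_insert_le hx).trans ((add_le_add (ih Q) (ih _)).trans
        (card_posSets_add_card_posSets_le hx (Q.smul_mem (g x)⁻¹ hg) (by simp [hgx]) hloop))
    · push Not at hloop
      obtain ⟨y, hyA, hy, p, hpQ, hpy⟩ := hloop
      have hxy (q : X → ℝ) (hqQ : q ∈ Q) : q x = 0 ↔ q y = 0 :=
        ⟨fun h ↦ hy q (mem_vanishingAt.2 ⟨hqQ, h⟩),
          eq_zero_of_forall_vanishingAt hy hpQ hpy hqQ⟩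
      exact (card_zeroSets_insert_le_of_zero_iff hx fun q hq r hr hqr ↦
        (hxy q hq).trans ((hqr y hyA).trans (hxy r hr).symm)).trans
          ((ih Q).trans (card_posSets_le_card_posSets_insert hx))

end SignPatterns

/-! ### The rank of evaluation vectors -/

section LowWeight

/-- The number of `k < N` with fewer than `d` nonzero binary digits. -/
def lowWeightCount (d N : ℕ) : ℕ :=
  N.count fun k ↦ k.bitIndices.length < d

lemma lowWeightCount_succ (d N : ℕ) :
    lowWeightCount d (N + 1) = lowWeightCount d N + if N.bitIndices.length < d then 1 else 0 :=
  Nat.count_succ _ N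

lemma lowWeightCount_one {d : ℕ} (hd : 0 < d) : lowWeightCount d 1 = 1 := by
  simpa [lowWeightCount, hd] using lowWeightCount_succ d 0

lemma lowWeightCount_two_mul (d N : ℕ) :
    lowWeightCount d (2 * N) = lowWeightCount d N + lowWeightCount (d - 1) N := by
  induction N with
  | zero => simp [lowWeightCount]
  | succ N ih =>
    simp only [mul_add, mul_one, lowWeightCount_succ, Nat.bitIndices_two_mul,
      Nat.bitIndices_two_mul_add_one, List.length_map, List.length_cons, ih, Nat.lt_sub_iff_add_lt]
    ring

lemma lowWeightCount_two_mul_add_one (d N : ℕ) :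
    lowWeightCount d (2 * N + 1) = lowWeightCount d (N + 1) + lowWeightCount (d - 1) N := by
  simp only [lowWeightCount_succ, lowWeightCount_two_mul, Nat.bitIndices_two_mul, List.length_map]
  ring

lemma lowWeightCount_add_le {a b : ℕ} (hab : b ≤ a) (d : ℕ) :
    lowWeightCount d (a + b) ≤ lowWeightCount d a + lowWeightCount (d - 1) b := by
  induction hN : a + b using Nat.strong_induction_on generalizing a b d with
  | _ N ih =>
    subst hN
    have ih' {a' b' : ℕ} (d : ℕ) (hlt : a' + b' < a + b) (hle : b' ≤ a') := ih _ hlt hle d rfl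
    clear ih
    obtain rfl | hb := b.eq_zero_or_pos
    · simp
    rcases a.even_or_odd' with ⟨r, rfl | rfl⟩ <;> rcases b.even_or_odd' with ⟨s, rfl | rfl⟩
    · rw [← mul_add]
      simp only [lowWeightCount_two_mul]
      have h₁ := ih' d (a' := r) (b' := s) (by lia) (by lia)
      have h₂ := ih' (d - 1) (a' := r) (b' := s) (by lia) (by lia)
      lia
    · rw [← add_assoc, ← mul_add]
      simp only [lowWeightCount_two_mul, lowWeightCount_two_mul_add_one]
      have h₁ := ih' d (a' := r) (b' := s + 1) (by lia) (by lia)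
      have h₂ := ih' (d - 1) (a' := r) (b' := s) (by lia) (by lia)
      lia
    · rw [add_right_comm, ← mul_add]
      simp only [lowWeightCount_two_mul, lowWeightCount_two_mul_add_one]
      have h₁ := ih' d (a' := r + 1) (b' := s) (by lia) (by lia)
      have h₂ := ih' (d - 1) (a' := r) (b' := s) (by lia) (by lia)
      rw [add_right_comm] at h₁
      lia
    · rw [show 2 * r + 1 + (2 * s + 1) = 2 * (r + s + 1) by ring]
      simp only [lowWeightCount_two_mul, lowWeightCount_two_mul_add_one]
      have h₁ := ih' d (a' := r + 1) (b' := s) (by lia) (by lia)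
      rw [add_right_comm] at h₁
      obtain rfl | hsr := (show s ≤ r by lia).eq_or_lt
      · have h₂ := ih' (d - 1) (a' := s + 1) (b' := s) (by lia) (by lia)
        rw [add_right_comm] at h₂
        lia
      · have h₂ := ih' (d - 1) (a' := r) (b' := s + 1) (by lia) (by lia)
        rw [← add_assoc] at h₂
        have hstep : lowWeightCount (d - 1) s + lowWeightCount (d - 1 - 1) (s + 1) ≤
            lowWeightCount (d - 1) (s + 1) + lowWeightCount (d - 1 - 1) s := by
          simp only [lowWeightCount_succ]
          split_ifs <;> lia
        lia

lemma lowWeightCount_two_pow (d m : ℕ) :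
    lowWeightCount d (2 ^ m) = ∑ i ∈ range d, m.choose i := by
  induction m generalizing d with
  | zero =>
    cases d with
    | zero => simp [lowWeightCount]
    | succ d => simp [lowWeightCount_one, sum_range_succ']
  | succ m ih =>
    rw [pow_succ', lowWeightCount_two_mul, ih, ih]
    cases d with
    | zero => simp
    | succ d =>
      simp only [Nat.add_sub_cancel, sum_range_succ', Nat.choose_succ_succ, sum_add_distrib,
        Nat.choose_zero_right]
      ring

end LowWeight

section EvaluationVectors

variable {𝕜 α : Type*} [Field 𝕜] [DecidableEq α] {d : ℕ} {a : α} {A : Finset α}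

/-- The values at the indicator vector of `A` of the multilinear monomials `∏ i ∈ B, X i` of degree
less than `d`, padded by zeros for the other sets `B`. -/
def evalVec (𝕜 : Type*) [Zero 𝕜] [One 𝕜] (d : ℕ) (A B : Finset α) : 𝕜 :=
  if #B < d ∧ B ⊆ A then 1 else 0

/-- Set the coordinates of the monomials divisible by `X a` to zero. -/
def dropVar (𝕜 : Type*) [Field 𝕜] (a : α) : (Finset α → 𝕜) →ₗ[𝕜] (Finset α → 𝕜) where
  toFun v B := if a ∈ B then 0 else v B
  map_add' v w := by ext B; by_cases h : a ∈ B <;> simp [h]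
  map_smul' c v := by ext B; by_cases h : a ∈ B <;> simp [h]

/-- Divide by `X a` the monomials divisible by it, and drop the others. -/
def divVar (𝕜 : Type*) [Field 𝕜] (a : α) : (Finset α → 𝕜) →ₗ[𝕜] (Finset α → 𝕜) where
  toFun v B := if a ∈ B then 0 else v (insert a B)
  map_add' v w := by ext B; by_cases h : a ∈ B <;> simp [h]
  map_smul' c v := by ext B; by_cases h : a ∈ B <;> simp [h]

lemma dropVar_evalVec (a : α) (A : Finset α) :
    dropVar 𝕜 a (evalVec 𝕜 d A) = evalVec 𝕜 d (A.erase a) := by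
  ext B
  simp only [dropVar, LinearMap.coe_mk, AddHom.coe_mk, evalVec, subset_erase]
  split_ifs <;> simp_all

lemma divVar_evalVec_insert_sub (ha : a ∉ A) :
    divVar 𝕜 a (evalVec 𝕜 d (insert a A) - evalVec 𝕜 d A) = evalVec 𝕜 (d - 1) A := by
  ext B
  by_cases haB : a ∈ B
  · have hBA : ¬B ⊆ A := fun h ↦ ha (h haB)
    simp [divVar, evalVec, haB, hBA]
  · have hBA : ¬insert a B ⊆ A := fun h ↦ ha (h (mem_insert_self a B))
    simp [divVar, evalVec, haB, hBA, card_insert_of_notMem, insert_subset_insert_iff,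
      Nat.lt_sub_iff_add_lt]

lemma finrank_map_add_finrank_inf_ker {V W : Type*} [AddCommGroup V] [Module 𝕜 V]
    [FiniteDimensional 𝕜 V] [AddCommGroup W] [Module 𝕜 W] (f : V →ₗ[𝕜] W) (U : Submodule 𝕜 V) :
    finrank 𝕜 (U.map f) + finrank 𝕜 ↥(U ⊓ LinearMap.ker f) = finrank 𝕜 U := by
  rw [← (f.domRestrict U).finrank_range_add_finrank_ker, LinearMap.range_domRestrict,
    LinearMap.ker_domRestrict, ← Submodule.map_comap_subtype, Submodule.finrank_map_subtype_eq]

variable (𝕜 d) in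
/-- The dimension of the span of the evaluation vectors of the points of `Z`, that is, the value
at `d - 1` of the affine Hilbert function of `Z`. -/
noncomputable def evalRank (Z : Finset (Finset α)) : ℕ :=
  finrank 𝕜 (Submodule.span 𝕜 (evalVec 𝕜 d '' (Z : Set (Finset α))))

variable [Finite α]

lemma evalRank_union_add_evalRank_inter_le (Z : Finset (Finset α)) (a : α) :
    evalRank 𝕜 d (Z.memberSubfamily a ∪ Z.nonMemberSubfamily a) +
      evalRank 𝕜 (d - 1) (Z.memberSubfamily a ∩ Z.nonMemberSubfamily a) ≤ evalRank 𝕜 d Z := by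
  set U := Submodule.span 𝕜 (evalVec 𝕜 d '' (Z : Set (Finset α)))
  have hU {A : Finset α} (hA : A ∈ Z) : evalVec 𝕜 d A ∈ U :=
    Submodule.subset_span (Set.mem_image_of_mem _ hA)
  have himage : evalVec 𝕜 d '' ↑(Z.memberSubfamily a ∪ Z.nonMemberSubfamily a) =
      dropVar 𝕜 a '' (evalVec 𝕜 d '' Z) := by
    rw [memberSubfamily_union_nonMemberSubfamily, coe_image, Set.image_image, Set.image_image]
    exact Set.image_congr fun A _ ↦ (dropVar_evalVec a A).symm
  rw [evalRank, evalRank, evalRank, ← finrank_map_add_finrank_inf_ker (dropVar 𝕜 a) U, himage,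
    ← Submodule.map_span]
  refine add_le_add_right ?_ _
  refine (Submodule.finrank_mono (Submodule.span_le.2 ?_)).trans
    (Submodule.finrank_map_le (divVar 𝕜 a) (U ⊓ LinearMap.ker (dropVar 𝕜 a)))
  rintro _ ⟨A, hA, rfl⟩
  obtain ⟨hA₁, hA₀⟩ := mem_inter.1 (mem_coe.1 hA)
  obtain ⟨hA₁, haA⟩ := mem_memberSubfamily.1 hA₁
  refine ⟨_, ⟨U.sub_mem (hU hA₁) (hU (mem_nonMemberSubfamily.1 hA₀).1), ?_⟩,
    divVar_evalVec_insert_sub haA⟩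
  rw [SetLike.mem_coe, LinearMap.mem_ker, map_sub, dropVar_evalVec, dropVar_evalVec,
    erase_insert_eq_erase, sub_self]

variable (𝕜 d) in
/-- Equality holds if `Z` consists of the sets of binary digits of the numbers below `#Z`. -/
theorem lowWeightCount_card_le_evalRank (Z : Finset (Finset α)) :
    lowWeightCount d #Z ≤ evalRank 𝕜 d Z := by
  suffices h : ∀ S : Finset α, Z ⊆ S.powerset → lowWeightCount d #Z ≤ evalRank 𝕜 d Z from
    h (Z.biUnion id) fun A hA ↦ mem_powerset.2 (subset_biUnion_of_mem id hA)
  intro S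
  induction S using Finset.induction generalizing Z d with
  | empty =>
    intro hZ
    obtain rfl | rfl := subset_singleton_iff.1 (powerset_empty (α := α) ▸ hZ)
    · simp [lowWeightCount]
    obtain rfl | hd := d.eq_zero_or_pos
    · simp [lowWeightCount]
    have hne : evalVec 𝕜 d (∅ : Finset α) ≠ 0 := fun h ↦ by
      simpa [evalVec, hd] using congrFun h ∅
    rw [card_singleton, lowWeightCount_one hd, evalRank, coe_singleton, Set.image_singleton,
      finrank_span_singleton hne]
  | insert a S _ ih =>
    intro hZ
    have hsub : Z.memberSubfamily a ∪ Z.nonMemberSubfamily a ⊆ S.powerset := by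
      rw [memberSubfamily_union_nonMemberSubfamily]
      refine image_subset_iff.2 fun A hA ↦ mem_powerset.2 ?_
      exact subset_insert_iff.1 (mem_powerset.1 (hZ hA))
    rw [← card_memberSubfamily_add_card_nonMemberSubfamily a Z, ← card_union_add_card_inter]
    exact (lowWeightCount_add_le (card_le_card (inter_subset_union)) d).trans
      ((add_le_add (ih d _ hsub) (ih (d - 1) _ (inter_subset_union.trans hsub))).trans
        (evalRank_union_add_evalRank_inter_le Z a))

lemma sum_choose_le_finrank {m : ℕ} {Z : Finset (Finset α)} {V : Submodule 𝕜 (Finset α → 𝕜)}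
    (hZ : ∀ A ∈ Z, evalVec 𝕜 d A ∈ V) (hcard : 2 ^ m ≤ #Z) :
    ∑ i ∈ range d, m.choose i ≤ finrank 𝕜 V :=
  calc ∑ i ∈ range d, m.choose i = lowWeightCount d (2 ^ m) := (lowWeightCount_two_pow d m).symm
    _ ≤ lowWeightCount d #Z := Nat.count_monotone _ hcard
    _ ≤ evalRank 𝕜 d Z := lowWeightCount_card_le_evalRank 𝕜 d Z
    _ ≤ finrank 𝕜 V :=
      Submodule.finrank_mono (Submodule.span_le.2 (Set.image_subset_iff.2 fun A hA ↦ hZ A hA))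

end EvaluationVectors

/-! ### The Littlewood–Offord inequality -/

section LittlewoodOfford

lemma centralBinom_sq_mul_le (m : ℕ) : m.centralBinom ^ 2 * (2 * m + 1) ≤ 16 ^ m := by
  induction m with
  | zero => simp
  | succ m ih =>
    refine Nat.le_of_mul_le_mul_left ?_ (by positivity : 0 < (m + 1) ^ 2)
    calc (m + 1) ^ 2 * ((m + 1).centralBinom ^ 2 * (2 * (m + 1) + 1))
        = ((m + 1) * (m + 1).centralBinom) ^ 2 * (2 * m + 3) := by ring
      _ = (m.centralBinom ^ 2 * (2 * m + 1)) * (4 * (2 * m + 1) * (2 * m + 3)) := by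
        rw [Nat.succ_mul_centralBinom_succ]
        ring
      _ ≤ 16 ^ m * (16 * (m + 1) ^ 2) := Nat.mul_le_mul ih (by nlinarith)
      _ = (m + 1) ^ 2 * 16 ^ (m + 1) := by ring

lemma choose_half_sq_mul_le (t : ℕ) : t.choose (t / 2) ^ 2 * t ≤ 4 ^ t := by
  obtain ⟨m, rfl | rfl⟩ := t.even_or_odd'
  · have h := centralBinom_sq_mul_le m
    rw [Nat.centralBinom] at h
    rw [Nat.mul_div_cancel_left _ two_pos, pow_mul]
    exact (Nat.mul_le_mul_left _ (Nat.le_succ _)).trans h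
  · have h := centralBinom_sq_mul_le (m + 1)
    rw [Nat.centralBinom_eq_two_mul_choose, show 2 * (m + 1) = 2 * m + 1 + 1 by ring,
      Nat.choose_succ_succ', Nat.choose_symm_half, pow_succ 16] at h
    rw [show (2 * m + 1) / 2 = m by lia, pow_succ 4, pow_mul]
    norm_num
    nlinarith [Nat.zero_le ((2 * m + 1).choose m ^ 2)]

variable {ι G : Type*} [Fintype ι] [AddCommGroup G] [LinearOrder G]
  [IsOrderedAddMonoid G] {c : ι → G}

lemma card_sum_eq_le_of_pos (hc : ∀ i, 0 < c i) (b : G) :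
    #{I : Finset ι | ∑ i ∈ I, c i = b} ≤ (Fintype.card ι).choose (Fintype.card ι / 2) := by
  refine IsAntichain.sperner fun I hI J hJ hne hIJ ↦ ?_
  obtain ⟨i, hiJ, hiI⟩ := exists_of_ssubset (hIJ.ssubset_of_ne hne)
  refine (sum_lt_sum_of_subset hIJ hiJ hiI (hc i) fun j _ _ ↦ (hc j).le).ne ?_
  simp_all

lemma sum_symmDiff_abs [DecidableEq ι] (c : ι → G) (I : Finset ι) :
    ∑ i ∈ symmDiff I ({i | c i < 0} : Finset ι), |c i| =
      ∑ i ∈ I, c i + ∑ i with c i < 0, |c i| := by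
  simp only [← sum_ite_mem_eq (s := symmDiff I _), ← sum_ite_mem_eq (s := I), sum_filter,
    ← sum_add_distrib, mem_symmDiff, mem_filter_univ]
  refine sum_congr rfl fun i _ ↦ ?_
  rcases lt_or_ge (c i) 0 with hi | hi <;> by_cases hiI : i ∈ I <;>
    simp [hi, hiI, not_lt.2, abs_of_neg, abs_of_nonneg]

lemma card_sum_eq_le_of_ne_zero (hc : ∀ i, c i ≠ 0) (b : G) :
    #{I : Finset ι | ∑ i ∈ I, c i = b} ≤ (Fintype.card ι).choose (Fintype.card ι / 2) := by
  classical
  refine le_trans ?_ (card_sum_eq_le_of_pos (fun i ↦ abs_pos.2 (hc i))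
    (b + ∑ i with c i < 0, |c i|))
  refine card_le_card_of_injOn (fun I ↦ symmDiff I ({i | c i < 0} : Finset ι)) (fun I hI ↦ ?_)
    (symmDiff_left_injective _).injOn
  simp_all [sum_symmDiff_abs]

lemma card_sum_eq_le (c : ι → G) (b : G) {T : Finset ι} (hT : ∀ i ∈ T, c i ≠ 0) :
    #{I : Finset ι | ∑ i ∈ I, c i = b} ≤ (#T).choose (#T / 2) * 2 ^ (Fintype.card ι - #T) := by
  classical
  have hfibre (J : Finset ι) : #{I ∈ {I : Finset ι | ∑ i ∈ I, c i = b} | I \ T = J} ≤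
      (#T).choose (#T / 2) := by
    refine (card_le_card_of_injOn (fun I ↦ I.subtype (· ∈ T)) (fun I hI ↦ ?_)
      fun I hI I' hI' hII' ↦ ?_).trans ((card_sum_eq_le_of_ne_zero (c := fun i : T ↦ c i)
        (fun i ↦ hT i i.2) (b - ∑ i ∈ J, c i)).trans_eq (by rw [Fintype.card_coe]))
    · obtain ⟨hIb, rfl⟩ : ∑ i ∈ I, c i = b ∧ I \ T = J := by simpa using hI
      simp [sum_subtype_eq_sum_filter, ← hIb, eq_sub_iff_add_eq, filter_mem_eq_inter,
        sum_inter_add_sum_sdiff]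
    · have hIT : I ∩ T = I' ∩ T := by
        simpa [subtype_map, filter_mem_eq_inter] using
          congrArg (Finset.map (Function.Embedding.subtype (· ∈ T))) hII'
      rw [← sdiff_union_inter I T, ← sdiff_union_inter I' T, hIT]
      simp_all
  have hmaps : ∀ I ∈ ({I : Finset ι | ∑ i ∈ I, c i = b} : Finset (Finset ι)),
      I \ T ∈ Tᶜ.powerset := fun I _ ↦ mem_powerset.2 fun i hi ↦ by simp_all
  simpa [card_compl] using card_le_mul_card_image_of_maps_to hmaps _ fun J _ ↦ hfibre J

/-- **Littlewood–Offord**: a proportion of at most `1 / √s` of the subset sums of a family with `s`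
nonzero terms takes any given value. -/
theorem card_sum_eq_sq_mul_le {s : ℕ} (c : ι → G) (b : G) (hs : s ≤ #{i | c i ≠ 0}) :
    #{I : Finset ι | ∑ i ∈ I, c i = b} ^ 2 * s ≤ 4 ^ Fintype.card ι := by
  set T : Finset ι := {i | c i ≠ 0}
  calc #{I : Finset ι | ∑ i ∈ I, c i = b} ^ 2 * s
      ≤ ((#T).choose (#T / 2) * 2 ^ (Fintype.card ι - #T)) ^ 2 * #T := by
        gcongr
        exact card_sum_eq_le c b fun i hi ↦ (mem_filter.1 hi).2
    _ = ((#T).choose (#T / 2) ^ 2 * #T) * 4 ^ (Fintype.card ι - #T) := by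
      rw [mul_pow, pow_right_comm]
      ring
    _ ≤ 4 ^ #T * 4 ^ (Fintype.card ι - #T) := Nat.mul_le_mul_right _ (choose_half_sq_mul_le _)
    _ = 4 ^ Fintype.card ι := by rw [← pow_add, Nat.add_sub_of_le (card_le_univ T)]

end LittlewoodOfford

/-! ### Counting the flats spanned by tuples of points of the cube -/

section Flats

variable {X ι : Type*} [Fintype X] {Q : Submodule ℝ (X → ℝ)} {S : ι → X}

open Classical in
/-- The closure of the tuple `S`: the common zeros of the members of `Q` that vanish on `S`. -/
noncomputable def flat (Q : Submodule ℝ (X → ℝ)) (S : ι → X) : Finset X :=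
  {y | ∀ p ∈ Q, (∀ i, p (S i) = 0) → p y = 0}

lemma mem_flat {y : X} : y ∈ flat Q S ↔ ∀ p ∈ Q, (∀ i, p (S i) = 0) → p y = 0 := by
  simp [flat]

lemma mem_flat_self (i : ι) : S i ∈ flat Q S :=
  mem_flat.2 fun _ _ h ↦ h i

lemma flat_mem_zeroSets (Q : Submodule ℝ (X → ℝ)) (S : ι → X) : flat Q S ∈ zeroSets Q univ := by
  let U : Submodule ℝ (X → ℝ) := Q ⊓ ⨅ i, vanishingAt ⊤ (S i)
  have hU (p : X → ℝ) : p ∈ U ↔ p ∈ Q ∧ ∀ i, p (S i) = 0 := by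
    simp [U, Submodule.mem_iInf, mem_vanishingAt]
  obtain ⟨p, hpU, hp⟩ := exists_isGeneric U univ
  obtain ⟨hpQ, hpS⟩ := (hU p).1 hpU
  refine mem_zeroSets.2 ⟨p, hpQ, ?_⟩
  ext y
  rw [mem_filter_univ, mem_flat]
  exact ⟨fun h q hq hqS ↦ hp y (mem_univ y) h q ((hU q).2 ⟨hq, hqS⟩), fun h ↦ h p hpQ hpS⟩

lemma exists_coeff_of_mem_flat [Fintype ι] {y : X} (hy : y ∈ flat Q S) :
    ∃ c : ι → ℝ, ∀ p ∈ Q, p y = ∑ i, c i * p (S i) := by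
  let ev (x : X) : Q →ₗ[ℝ] ℝ := LinearMap.proj x ∘ₗ Q.subtype
  have h : ev y ∈ Submodule.span ℝ (Set.range fun i ↦ ev (S i)) := by
    refine mem_span_of_iInf_ker_le_ker fun p hp ↦ ?_
    simp only [Submodule.mem_iInf, LinearMap.mem_ker] at hp
    exact mem_flat.1 hy p p.2 hp
  obtain ⟨c, hc⟩ := (Submodule.mem_span_range_iff_exists_fun ℝ).1 h
  exact ⟨c, fun p hp ↦ by simpa [ev] using (LinearMap.congr_fun hc ⟨p, hp⟩).symm⟩

end Flats

section Tuples

variable {𝕜 α ι : Type*} [Field 𝕜] [Fintype α] [DecidableEq α] {d m s : ℕ}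

open Classical in
lemma two_pow_le_card_notMem (hm : m < Fintype.card α) {V : Submodule 𝕜 (Finset α → 𝕜)}
    (hV : finrank 𝕜 V < ∑ i ∈ range d, m.choose i) :
    2 ^ m ≤ #{A : Finset α | evalVec 𝕜 d A ∉ V} := by
  have hlt : #{A : Finset α | evalVec 𝕜 d A ∈ V} < 2 ^ m := by
    by_contra! h
    exact hV.not_ge (sum_choose_le_finrank (fun A hA ↦ (mem_filter.1 hA).2) h)
  have htotal := card_filter_add_card_filter_not (s := univ) fun A : Finset α ↦ evalVec 𝕜 d A ∈ V
  have hpow : 2 ^ (m + 1) ≤ 2 ^ Fintype.card α := Nat.pow_le_pow_right two_pos hm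
  rw [card_univ, Fintype.card_finset] at htotal
  lia

open Classical in
lemma two_pow_mul_le_card_linearIndependent {k : ℕ} (hm : m < Fintype.card α)
    (hk : k ≤ ∑ i ∈ range d, m.choose i) :
    2 ^ (m * k) ≤
      #{S : Fin k → Finset α | LinearIndependent 𝕜 fun i ↦ evalVec 𝕜 d (S i)} := by
  induction k with
  | zero => simp
  | succ k ih =>
    rw [mul_add, pow_add, mul_one, mul_comm]
    refine (Nat.mul_le_mul_left _ (ih (Nat.le_of_succ_le hk))).trans
      (mul_card_image_le_card_of_maps_to (f := fun S : Fin (k + 1) → Finset α ↦ Fin.tail S)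
        (fun S hS ↦ ?_) _ fun S hS ↦ ?_)
    · exact mem_filter_univ _ |>.2 ((mem_filter_univ _ |>.1 hS).comp _ (Fin.succ_injective _))
    · have hrank : finrank 𝕜 (Submodule.span 𝕜 (Set.range fun i ↦ evalVec 𝕜 d (S i))) ≤ k :=
        (finrank_range_le_card _).trans_eq (Fintype.card_fin k)
      refine (two_pow_le_card_notMem hm (hrank.trans_lt hk)).trans
        (card_le_card_of_injOn (fun A ↦ (Fin.cons A S : Fin (k + 1) → Finset α))
          (fun A hA ↦ ?_) fun A _ B _ h ↦ by simpa using congrFun h 0)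
      have hcons : (fun i ↦ evalVec 𝕜 d (Fin.cons (α := fun _ ↦ Finset α) A S i)) =
          Fin.cons (evalVec 𝕜 d A) fun i ↦ evalVec 𝕜 d (S i) := by
        ext1 i
        cases i using Fin.cases <;> simp
      simp_all [linearIndependent_finCons]

lemma succ_le_sum_choose (hd : 2 ≤ d) (s : ℕ) : s + 1 ≤ ∑ i ∈ range d, s.choose i := by
  simpa [sum_range_succ, add_comm] using
    sum_le_sum_of_subset (f := fun i ↦ s.choose i) (range_mono hd)

lemma exists_fin_subset_range [Nonempty ι] {T : Finset ι} (hT : #T ≤ s) :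
    ∃ u : Fin s → ι, ∀ i ∈ T, i ∈ Set.range u := by
  obtain ⟨f⟩ : Nonempty (T ↪ Fin s) := Function.Embedding.nonempty_of_card_le (by simpa using hT)
  refine ⟨Function.extend f (↑) fun _ ↦ Classical.arbitrary ι, fun i hi ↦ ⟨f ⟨i, hi⟩, ?_⟩⟩
  rw [f.injective.extend_apply]

variable [Fintype ι]

open Classical in
lemma card_span_small_le [Nonempty ι] (hd : 2 ≤ d) (S : ι → Finset α) (s : ℕ) :
    #{A : Finset α | ∃ c : ι → 𝕜, evalVec 𝕜 d A = ∑ i, c i • evalVec 𝕜 d (S i) ∧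
      #{i | c i ≠ 0} ≤ s} ≤ Fintype.card ι ^ s * 2 ^ s := by
  let W (u : Fin s → ι) : Finset (Finset α) :=
    {A | evalVec 𝕜 d A ∈ Submodule.span 𝕜 (Set.range fun j ↦ evalVec 𝕜 d (S (u j)))}
  have hW (u : Fin s → ι) : #(W u) ≤ 2 ^ s := by
    by_contra! h
    have hrank : finrank 𝕜
        (Submodule.span 𝕜 (Set.range fun j ↦ evalVec 𝕜 d (S (u j)))) ≤ s :=
      (finrank_range_le_card _).trans_eq (Fintype.card_fin s)
    have := sum_choose_le_finrank (fun A hA ↦ (mem_filter.1 hA).2) h.le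
    have := succ_le_sum_choose hd s
    lia
  calc _ ≤ #(univ.biUnion W) := card_le_card fun A hA ↦ ?_
    _ ≤ Fintype.card (Fin s → ι) * 2 ^ s := card_biUnion_le_card_mul _ _ _ fun u _ ↦ hW u
    _ = Fintype.card ι ^ s * 2 ^ s := by simp
  obtain ⟨c, hA, hc⟩ := mem_filter_univ _ |>.1 hA
  obtain ⟨u, hu⟩ := exists_fin_subset_range hc
  refine mem_biUnion.2 ⟨u, mem_univ u, mem_filter_univ _ |>.2 (hA ▸ ?_)⟩
  refine Submodule.sum_mem _ fun i _ ↦ ?_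
  rcases eq_or_ne (c i) 0 with hi | hi
  · simp [hi]
  obtain ⟨j, rfl⟩ := hu i (by simpa using hi)
  exact Submodule.smul_mem _ _ (Submodule.subset_span ⟨j, rfl⟩)

end Tuples

section AvoidsLarge

variable {X α β ι : Type*} [Fintype β]

section RowPoint

variable [DecidableEq ι]

/-- The matrix of points of the cube on `α ⊕ β` with rows `S` on `α` and columns `τ` on `β`. -/
def rowPoint (e : X ≃ Finset α × Finset β) (S : ι → Finset α) (τ : β → Finset ι) (i : ι) : X :=
  e.symm (S i, ({j | i ∈ τ j} : Finset β))

lemma rowPoint_injective (e : X ≃ Finset α × Finset β) :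
    Function.Injective fun p : (ι → Finset α) × (β → Finset ι) ↦ rowPoint e p.1 p.2 := by
  rintro ⟨S, τ⟩ ⟨S', τ'⟩ h
  have hrow (i : ι) : (S i, ({j | i ∈ τ j} : Finset β)) = (S' i, ({j | i ∈ τ' j} : Finset β)) :=
    e.symm.injective (congrFun h i)
  refine Prod.ext (funext fun i ↦ congrArg Prod.fst (hrow i)) (funext fun j ↦ ?_)
  ext i
  simpa using Finset.ext_iff.1 (congrArg Prod.snd (hrow i)) j

end RowPoint

variable [Fintype ι] [DecidableEq α] {d s : ℕ}

/-- No combination of the points of `S` with at least `s` terms that represents a point of the cube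
on `α` extends, with the columns `τ`, to a point of the cube on `α ⊕ β`. -/
def AvoidsLarge (d s : ℕ) (S : ι → Finset α) (τ : β → Finset ι) : Prop :=
  ∀ (A : Finset α) (c : ι → ℝ), evalVec ℝ d A = ∑ i, c i • evalVec ℝ d (S i) →
    s ≤ #{i | c i ≠ 0} → ∃ j, ∑ i ∈ τ j, c i ≠ 0 ∧ ∑ i ∈ τ j, c i ≠ 1

variable [DecidableEq β]

open Classical in
lemma two_pow_mul_card_columns_le (c : ι → ℝ) (hs : s ≤ #{i | c i ≠ 0}) {r : ℕ}
    (hr : 4 ^ (r + Fintype.card β) ≤ s ^ Fintype.card β) :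
    2 ^ r * #{τ : β → Finset ι | ∀ j, ∑ i ∈ τ j, c i = 0 ∨ ∑ i ∈ τ j, c i = 1} ≤
      2 ^ (Fintype.card ι * Fintype.card β) := by
  set W : Finset (Finset ι) := {I | ∑ i ∈ I, c i = 0 ∨ ∑ i ∈ I, c i = 1}
  have hW : #W ^ 2 * s ≤ 4 * 4 ^ Fintype.card ι := by
    have hunion : #W ≤ #{I : Finset ι | ∑ i ∈ I, c i = 0} + #{I : Finset ι | ∑ i ∈ I, c i = 1} := by
      rw [show W = _ from filter_or ..]
      exact card_union_le _ _
    have h₀ := card_sum_eq_sq_mul_le c 0 hs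
    have h₁ := card_sum_eq_sq_mul_le c 1 hs
    set w₀ := #{I : Finset ι | ∑ i ∈ I, c i = 0}
    set w₁ := #{I : Finset ι | ∑ i ∈ I, c i = 1}
    calc #W ^ 2 * s ≤ (w₀ + w₁) ^ 2 * s := by gcongr
      _ ≤ 2 * (w₀ ^ 2 + w₁ ^ 2) * s := by
        gcongr
        exact add_sq_le
      _ ≤ 4 * 4 ^ Fintype.card ι := by lia
  have hpi : ({τ : β → Finset ι | ∀ j, ∑ i ∈ τ j, c i = 0 ∨ ∑ i ∈ τ j, c i = 1} : Finset _) =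
      Fintype.piFinset fun _ ↦ W := by
    ext τ
    simp [W, Fintype.mem_piFinset]
  rw [hpi, Fintype.card_piFinset, prod_const, card_univ]
  refine (Nat.pow_le_pow_iff_left two_ne_zero).1
    (Nat.le_of_mul_le_mul_right ?_ (by positivity : 0 < 4 ^ Fintype.card β))
  calc (2 ^ r * #W ^ Fintype.card β) ^ 2 * 4 ^ Fintype.card β
      = 4 ^ (r + Fintype.card β) * (#W ^ 2) ^ Fintype.card β := by
        rw [mul_pow, pow_right_comm 2, pow_right_comm _ _ 2, pow_add]
        ring
    _ ≤ s ^ Fintype.card β * (#W ^ 2) ^ Fintype.card β := by gcongr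
    _ = (#W ^ 2 * s) ^ Fintype.card β := by rw [mul_pow, mul_comm]
    _ ≤ (4 * 4 ^ Fintype.card ι) ^ Fintype.card β := by gcongr
    _ = (2 ^ (Fintype.card ι * Fintype.card β)) ^ 2 * 4 ^ Fintype.card β := by
      rw [mul_pow, ← pow_mul, pow_right_comm 2, mul_comm]
      norm_num

variable [Fintype α]

open Classical in
lemma two_pow_le_card_avoidsLarge {S : ι → Finset α}
    (hS : LinearIndependent ℝ fun i ↦ evalVec ℝ d (S i))
    (hs : 4 ^ (Fintype.card α + 1 + Fintype.card β) ≤ s ^ Fintype.card β) :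
    2 ^ (Fintype.card ι * Fintype.card β) ≤
      2 * #{τ : β → Finset ι | AvoidsLarge d s S τ} := by
  let B (A : Finset α) : Finset (β → Finset ι) :=
    {τ | ∃ c : ι → ℝ, evalVec ℝ d A = ∑ i, c i • evalVec ℝ d (S i) ∧ s ≤ #{i | c i ≠ 0} ∧
      ∀ j, ∑ i ∈ τ j, c i = 0 ∨ ∑ i ∈ τ j, c i = 1}
  have hB (A : Finset α) : 2 ^ (Fintype.card α + 1) * #(B A) ≤
      2 ^ (Fintype.card ι * Fintype.card β) := by
    obtain hempty | ⟨τ₀, hτ₀⟩ := (B A).eq_empty_or_nonempty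
    · simp [hempty]
    obtain ⟨c, hc, hcs, -⟩ := (mem_filter.1 hτ₀).2
    refine (Nat.mul_le_mul_left _ (card_le_card fun τ hτ ↦ ?_)).trans
      (two_pow_mul_card_columns_le c hcs hs)
    obtain ⟨c', hc', -, hτ⟩ := mem_filter_univ _ |>.1 hτ
    obtain rfl : c = c' := hS.fintypeLinearCombination_injective (hc.symm.trans hc')
    exact mem_filter_univ _ |>.2 hτ
  have hbad : 2 * #{τ : β → Finset ι | ¬AvoidsLarge d s S τ} ≤
      2 ^ (Fintype.card ι * Fintype.card β) := by
    refine Nat.le_of_mul_le_mul_left ?_ (by positivity : 0 < 2 ^ Fintype.card α)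
    calc 2 ^ Fintype.card α * (2 * #{τ : β → Finset ι | ¬AvoidsLarge d s S τ})
        ≤ 2 ^ Fintype.card α * (2 * ∑ A, #(B A)) := by
          gcongr
          refine (card_le_card fun τ hτ ↦ ?_).trans card_biUnion_le
          simpa [AvoidsLarge, B, or_iff_not_imp_left] using hτ
      _ = ∑ A, 2 ^ (Fintype.card α + 1) * #(B A) := by rw [← mul_sum, pow_succ, mul_assoc]
      _ ≤ ∑ _A : Finset α, 2 ^ (Fintype.card ι * Fintype.card β) := sum_le_sum fun A _ ↦ hB A
      _ = 2 ^ Fintype.card α * 2 ^ (Fintype.card ι * Fintype.card β) := by simp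
  have htotal := card_filter_add_card_filter_not (s := univ)
    fun τ : β → Finset ι ↦ AvoidsLarge d s S τ
  rw [card_univ, Fintype.card_fun, Fintype.card_finset, ← pow_mul] at htotal
  lia

variable [Fintype X] [DecidableEq ι] {e : X ≃ Finset α × Finset β}
  {Q : Submodule ℝ (X → ℝ)}

omit [Fintype α] in
lemma card_flat_rowPoint_le [Finite α] [Nonempty ι]
    (hQ₁ : ∀ B : Finset α, #B < d → (fun x ↦ if B ⊆ (e x).1 then 1 else 0) ∈ Q)
    (hQ₂ : ∀ j, (fun x ↦ if j ∈ (e x).2 then 1 else 0) ∈ Q) (hd : 2 ≤ d)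
    {S : ι → Finset α} {τ : β → Finset ι} (hτ : AvoidsLarge d s S τ) :
    #(flat Q (rowPoint e S τ)) ≤ Fintype.card ι ^ s * 2 ^ s * 2 ^ Fintype.card β := by
  classical
  have := Fintype.ofFinite α
  have hmaps : ∀ y ∈ flat Q (rowPoint e S τ), e y ∈
      ({A | ∃ c : ι → ℝ, evalVec ℝ d A = ∑ i, c i • evalVec ℝ d (S i) ∧ #{i | c i ≠ 0} ≤ s} :
        Finset (Finset α)) ×ˢ univ := by
    intro y hy
    obtain ⟨c, hc⟩ := exists_coeff_of_mem_flat hy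
    have hrow : evalVec ℝ d (e y).1 = ∑ i, c i • evalVec ℝ d (S i) := by
      ext B
      by_cases hB : #B < d
      · simpa [evalVec, hB, rowPoint] using hc _ (hQ₁ B hB)
      · simp [evalVec, hB]
    refine mem_product.2 ⟨mem_filter_univ _ |>.2 ⟨c, hrow, ?_⟩, mem_univ _⟩
    by_contra! hlt
    obtain ⟨j, hj₀, hj₁⟩ := hτ _ c hrow hlt.le
    have hcol : (if j ∈ (e y).2 then 1 else 0) = ∑ i ∈ τ j, c i := by
      simpa [rowPoint, sum_ite_mem] using hc _ (hQ₂ j)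
    split_ifs at hcol with h
    · exact hj₁ hcol.symm
    · exact hj₀ hcol.symm
  refine (card_le_card_of_injOn e hmaps e.injective.injOn).trans ?_
  rw [card_product, card_univ, Fintype.card_finset]
  exact Nat.mul_le_mul_right _ (card_span_small_le hd S s)

open Classical in
lemma card_avoidsLarge_le [Nonempty ι]
    (hQ₁ : ∀ B : Finset α, #B < d → (fun x ↦ if B ⊆ (e x).1 then 1 else 0) ∈ Q)
    (hQ₂ : ∀ j, (fun x ↦ if j ∈ (e x).2 then 1 else 0) ∈ Q) (hd : 2 ≤ d) :
    #{p : (ι → Finset α) × (β → Finset ι) | AvoidsLarge d s p.1 p.2} ≤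
      (Fintype.card ι ^ s * 2 ^ s * 2 ^ Fintype.card β) ^ Fintype.card ι * #(zeroSets Q univ) := by
  set M := Fintype.card ι ^ s * 2 ^ s * 2 ^ Fintype.card β
  let T : Finset (ι → X) :=
    {Z ∈ zeroSets Q univ | #Z ≤ M}.biUnion fun Z ↦ Fintype.piFinset fun _ ↦ Z
  have hmaps : ∀ p : (ι → Finset α) × (β → Finset ι), AvoidsLarge d s p.1 p.2 →
      rowPoint e p.1 p.2 ∈ T := fun p hp ↦
    mem_biUnion.2 ⟨flat Q (rowPoint e p.1 p.2),
      mem_filter.2 ⟨flat_mem_zeroSets Q _, card_flat_rowPoint_le hQ₁ hQ₂ hd hp⟩,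
      Fintype.mem_piFinset.2 mem_flat_self⟩
  calc _ ≤ #T := card_le_card_of_injOn (fun p ↦ rowPoint e p.1 p.2)
        (fun p hp ↦ hmaps p (mem_filter_univ p |>.1 hp)) (rowPoint_injective e).injOn
    _ ≤ #{Z ∈ zeroSets Q univ | #Z ≤ M} * M ^ Fintype.card ι :=
      card_biUnion_le_card_mul _ _ _ fun Z hZ ↦ by
        rw [Fintype.card_piFinset, prod_const, card_univ]
        exact Nat.pow_le_pow_left (mem_filter.1 hZ).2 _
    _ ≤ M ^ Fintype.card ι * #(zeroSets Q univ) := by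
      rw [mul_comm]
      exact Nat.mul_le_mul_left _ (card_filter_le _ _)

open Classical in
theorem two_pow_le_mul_card_zeroSets {k m : ℕ}
    (hQ₁ : ∀ B : Finset α, #B < d → (fun x ↦ if B ⊆ (e x).1 then 1 else 0) ∈ Q)
    (hQ₂ : ∀ j, (fun x ↦ if j ∈ (e x).2 then 1 else 0) ∈ Q) (hd : 2 ≤ d) (hk : 1 ≤ k)
    (hm : m < Fintype.card α) (hkm : k ≤ ∑ i ∈ range d, m.choose i)
    (hs : 4 ^ (Fintype.card α + 1 + Fintype.card β) ≤ s ^ Fintype.card β) :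
    2 ^ ((m + Fintype.card β) * k) ≤
      2 * ((k ^ s * 2 ^ s * 2 ^ Fintype.card β) ^ k * #(zeroSets Q univ)) := by
  have : Nonempty (Fin k) := ⟨⟨0, hk⟩⟩
  set L : Finset (Fin k → Finset α) := {S | LinearIndependent ℝ fun i ↦ evalVec ℝ d (S i)}
  calc 2 ^ ((m + Fintype.card β) * k) = 2 ^ (m * k) * 2 ^ (k * Fintype.card β) := by
        rw [← pow_add]
        ring
    _ ≤ ∑ S ∈ L, 2 ^ (k * Fintype.card β) := by
      rw [sum_const, smul_eq_mul]
      exact Nat.mul_le_mul_right _ (two_pow_mul_le_card_linearIndependent hm hkm)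
    _ ≤ ∑ S ∈ L, 2 * #{τ : β → Finset (Fin k) | AvoidsLarge d s S τ} :=
      sum_le_sum fun S hS ↦ by
        simpa using two_pow_le_card_avoidsLarge (mem_filter.1 hS).2 hs
    _ ≤ 2 * #{p : (Fin k → Finset α) × (β → Finset (Fin k)) | AvoidsLarge d s p.1 p.2} := by
      rw [← mul_sum, ← card_sigma]
      refine Nat.mul_le_mul_left _ (card_le_card_of_injOn (Equiv.sigmaEquivProd _ _)
        (fun p hp ↦ ?_) (Equiv.injective _).injOn)
      exact mem_filter_univ _ |>.2 (mem_filter_univ _ |>.1 (mem_sigma.1 hp).2)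
    _ ≤ _ := by simpa using Nat.mul_le_mul_left 2 (card_avoidsLarge_le (ι := Fin k) hQ₁ hQ₂ hd)

end AvoidsLarge

/-! ### Polynomial threshold functions as sign patterns -/

section Shattering

variable {X : Type*} {Q : Submodule ℝ (X → ℝ)} {A S : Finset X}

lemma exists_pos_dual_of_finrank_lt_card [Finite X] (h : finrank ℝ Q < #S) :
    ∃ a : S → ℝ, (∃ x, 0 < a x) ∧ ∀ p ∈ Q, ∑ x : S, p x * a x = 0 := by
  classical
  let res : (X → ℝ) →ₗ[ℝ] (S → ℝ) := LinearMap.funLeft ℝ ℝ Subtype.val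
  have hne : Q.map res < ⊤ := by
    refine Submodule.lt_top_of_finrank_lt_finrank ((Submodule.finrank_map_le res Q).trans_lt ?_)
    rwa [finrank_fintype_fun_eq_card, Fintype.card_coe]
  obtain ⟨φ, hφ, hker⟩ := Submodule.exists_le_ker_of_lt_top _ hne
  obtain ⟨a, ha⟩ : ∃ a : S → ℝ, ∀ v, φ v = ∑ x, v x * a x :=
    ⟨_, LinearMap.pi_apply_eq_sum_univ φ⟩
  have hzero (p : X → ℝ) (hp : p ∈ Q) : ∑ x : S, p x * a x = 0 :=
    (ha (res p)).symm.trans (hker (Submodule.mem_map_of_mem hp))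
  obtain ⟨x, hx⟩ : ∃ x, a x ≠ 0 := by
    by_contra! h
    exact hφ (LinearMap.ext fun v ↦ by simp [ha v, h])
  rcases hx.lt_or_gt with hx | hx
  · refine ⟨-a, ⟨x, neg_pos.2 hx⟩, fun p hp ↦ ?_⟩
    simp only [Pi.neg_apply, mul_neg, sum_neg_distrib, hzero p hp, neg_zero]
  · exact ⟨a, ⟨x, hx⟩, hzero⟩

lemma card_le_finrank_of_shatters [Finite X] [DecidableEq X]
    (hS : (posSets Q A).Shatters S) : #S ≤ finrank ℝ Q := by
  by_contra! hlt
  obtain ⟨a, ⟨x₀, hx₀⟩, ha⟩ := exists_pos_dual_of_finrank_lt_card hlt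
  have hSA : S ⊆ A := by
    obtain ⟨P, hP, hSP⟩ := hS.exists_superset
    obtain ⟨p, -, -, rfl⟩ := mem_posSets.1 hP
    exact hSP.trans (filter_subset _ _)
  obtain ⟨P, hP, hSP⟩ := hS (map_subtype_subset ({x : S | 0 < a x} : Finset S))
  obtain ⟨p, hp, -, rfl⟩ := mem_posSets.1 hP
  have hpos (x : S) : 0 < p x ↔ 0 < a x := by
    simpa [hSA x.2] using Finset.ext_iff.1 hSP x
  have hterm (x : S) : 0 ≤ p x * a x := by
    rcases lt_or_ge 0 (a x) with hx | hx
    · exact (mul_pos ((hpos x).2 hx) hx).le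
    · exact mul_nonneg_of_nonpos_of_nonpos (not_lt.1 fun h ↦ hx.not_gt ((hpos x).1 h)) hx
  exact (sum_pos' (fun x _ ↦ hterm x)
    ⟨x₀, mem_univ _, mul_pos ((hpos x₀).2 hx₀) hx₀⟩).ne' (ha p hp)

theorem card_posSets_le_sum_choose [Fintype X] (Q : Submodule ℝ (X → ℝ)) (A : Finset X) :
    #(posSets Q A) ≤ ∑ i ∈ Iic (finrank ℝ Q), (Fintype.card X).choose i := by
  classical
  exact (card_le_card_shatterer _).trans (card_shatterer_le_sum_vcDim.trans
    (sum_le_sum_of_subset (Iic_subset_Iic.2 (Finset.sup_le fun _ hS ↦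
      card_le_finrank_of_shatters (mem_shatterer.1 hS)))))

end Shattering

section SignCube

variable {σ : Type*} {d : ℕ} {z : σ → ℤˣ}

/-- The point of `ℝ^σ` given by a sign vector. -/
def toReal (z : σ → ℤˣ) : σ → ℝ := fun i ↦ ((z i : ℤ) : ℝ)

/-- The functions on the sign cube given by real polynomials of total degree at most `d`. -/
noncomputable def polySpace (σ : Type*) (d : ℕ) : Submodule ℝ ((σ → ℤˣ) → ℝ) :=
  (MvPolynomial.restrictTotalDegree σ ℝ d).map
    (LinearMap.pi fun z ↦ (MvPolynomial.aeval (toReal z)).toLinearMap)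

lemma mem_polySpace {p : (σ → ℤˣ) → ℝ} :
    p ∈ polySpace σ d ↔
      ∃ P : MvPolynomial σ ℝ, P.totalDegree ≤ d ∧ ∀ z, MvPolynomial.eval (toReal z) P = p z := by
  simp [polySpace, MvPolynomial.mem_restrictTotalDegree, funext_iff, MvPolynomial.aeval_eq_eval]

lemma intCast_units_eq_ite (u : ℤˣ) : ((u : ℤ) : ℝ) = if u = 1 then 1 else -1 := by
  rcases Int.units_eq_one_or u with rfl | rfl
  · simp
  · simp [show (-1 : ℤˣ) ≠ 1 by decide]

lemma intCast_units_eq_sign_iff {a : ℝ} (ha : a ≠ 0) (u : ℤˣ) :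
    ((u : ℤ) : ℝ) = Real.sign a ↔ (u = 1 ↔ 0 < a) := by
  rw [intCast_units_eq_ite]
  rcases ha.lt_or_gt with h | h <;> split_ifs with hu <;>
    norm_num [hu, h, h.not_gt, Real.sign_of_neg, Real.sign_of_pos]

lemma IsGeneric.ne_zero {A : Finset (σ → ℤˣ)} {p : (σ → ℤˣ) → ℝ}
    (hp : IsGeneric (polySpace σ d) A p) (hz : z ∈ A) : p z ≠ 0 := fun h ↦
  one_ne_zero (hp z hz h 1 (mem_polySpace.2 ⟨1, by simp, by simp⟩))

lemma indicator_mem_polySpace {B : Finset σ} (hB : #B ≤ d) :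
    (fun z ↦ if ∀ i ∈ B, z i = 1 then 1 else 0) ∈ polySpace σ d := by
  refine mem_polySpace.2
    ⟨∏ i ∈ B, (MvPolynomial.C (1 / 2) * (MvPolynomial.X i + 1)), ?_, fun z ↦ ?_⟩
  · refine (MvPolynomial.totalDegree_finsetProd _ _).trans
      ((sum_le_card_nsmul _ _ 1 fun i _ ↦ ?_).trans (by simpa using hB))
    refine (MvPolynomial.totalDegree_mul _ _).trans ?_
    rw [MvPolynomial.totalDegree_C, zero_add]
    exact (MvPolynomial.totalDegree_add _ _).trans (by simp)
  · rw [← prod_const_one (s := B), ← prod_ite_zero, map_prod]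
    refine prod_congr rfl fun i _ ↦ ?_
    simp only [map_mul, MvPolynomial.eval_C, map_add, MvPolynomial.eval_X, map_one, toReal,
      intCast_units_eq_ite]
    split_ifs <;> norm_num

variable [Fintype σ]

lemma card_filter_card_lt (σ : Type*) [Fintype σ] (d : ℕ) :
    #{B : Finset σ | #B < d} = ∑ i ∈ range d, (Fintype.card σ).choose i := by
  rw [card_eq_sum_card_fiberwise (f := card) (t := range d) fun B hB ↦ by simpa using hB]
  refine sum_congr rfl fun i hi ↦ ?_
  rw [filter_filter, ← card_univ, ← card_powersetCard]
  congr 1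
  ext B
  simp only [mem_filter_univ, mem_powersetCard_univ, and_iff_right_iff_imp]
  rintro rfl
  exact mem_range.1 hi

lemma prod_toReal_pow_eq (z : σ → ℤˣ) (a : σ → ℕ) :
    ∏ i, toReal z i ^ a i = ∏ i with Odd (a i), toReal z i := by
  rw [prod_filter]
  refine prod_congr rfl fun i _ ↦ ?_
  have hsq : toReal z i ^ 2 = 1 := by
    rw [toReal, intCast_units_eq_ite]
    split_ifs <;> norm_num
  split_ifs with h
  · obtain ⟨k, hk⟩ := h
    rw [hk, pow_succ, pow_mul, hsq, one_pow, one_mul]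
  · obtain ⟨k, hk⟩ := Nat.not_odd_iff_even.1 h
    rw [hk, ← two_mul, pow_mul, hsq, one_pow]

lemma finrank_polySpace_le (σ : Type*) [Fintype σ] (d : ℕ) :
    finrank ℝ (polySpace σ d) ≤ ∑ i ∈ range (d + 1), (Fintype.card σ).choose i := by
  classical
  let χ : {B : Finset σ // #B < d + 1} → (σ → ℤˣ) → ℝ := fun B z ↦ ∏ i ∈ B.1, toReal z i
  have hspan : polySpace σ d ≤ Submodule.span ℝ (Set.range χ) := by
    intro p hp
    obtain ⟨P, hP, hPp⟩ := mem_polySpace.1 hp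
    have hsum : p = ∑ a ∈ P.support,
        P.coeff a • fun z ↦ ∏ i with Odd (a i), toReal z i := by
      ext z
      simp [← hPp z, MvPolynomial.eval_eq', prod_toReal_pow_eq]
    rw [hsum]
    refine Submodule.sum_mem _ fun a ha ↦ Submodule.smul_mem _ _
      (Submodule.subset_span ⟨⟨univ.filter fun i ↦ Odd (a i), Nat.lt_succ_of_le ?_⟩, rfl⟩)
    calc #{i | Odd (a i)} = ∑ i, if Odd (a i) then 1 else 0 := card_filter _ _
      _ ≤ ∑ i, a i := sum_le_sum fun i _ ↦ by
        split_ifs with h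
        exacts [h.pos, Nat.zero_le _]
      _ = a.sum fun _ e ↦ e := (a.sum_fintype (fun _ e ↦ e) fun _ ↦ rfl).symm
      _ ≤ d := (MvPolynomial.le_totalDegree ha).trans hP
  refine (Submodule.finrank_mono hspan).trans ((finrank_range_le_card _).trans_eq ?_)
  rw [Fintype.card_subtype, card_filter_card_lt]

variable [DecidableEq σ]

/-- The sign vector of a subset: `1` on the subset and `-1` off it. -/
def signEquiv (σ : Type*) [Fintype σ] [DecidableEq σ] : Finset σ ≃ (σ → ℤˣ) where
  toFun A i := if i ∈ A then 1 else -1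
  invFun z := {i | z i = 1}
  left_inv A := by
    ext i
    simp [ite_eq_left_iff, show (-1 : ℤˣ) ≠ 1 by decide]
  right_inv z := by
    ext1 i
    rcases Int.units_eq_one_or (z i) with h | h <;> simp [h]

lemma mem_signEquiv_symm {i : σ} : i ∈ (signEquiv σ).symm z ↔ z i = 1 :=
  mem_filter_univ i

end SignCube

section NumPTF

variable {n d : ℕ}

lemma mem_posSets_polySpace_iff {P : Finset (Fin n → ℤˣ)} :
    P ∈ posSets (polySpace (Fin n) d) univ ↔ IsPolynomialThreshold n d (signEquiv _ P) := by
  have hone (z : Fin n → ℤˣ) : signEquiv _ P z = 1 ↔ z ∈ P := by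
    rw [← mem_signEquiv_symm, Equiv.symm_apply_apply]
  rw [mem_posSets]
  constructor
  · rintro ⟨p, hp, hgen, hpos⟩
    obtain ⟨F, hF, hFp⟩ := mem_polySpace.1 hp
    refine ⟨F, hF, fun z ↦ ?_⟩
    have hz : MvPolynomial.eval (toReal z) F ≠ 0 := hFp z ▸ hgen.ne_zero (mem_univ z)
    refine ⟨hz, (intCast_units_eq_sign_iff hz _).2 ?_⟩
    rw [hone, ← hpos, mem_filter_univ, hFp]
  · rintro ⟨F, hF, h⟩
    refine ⟨fun z ↦ MvPolynomial.eval (toReal z) F, mem_polySpace.2 ⟨F, hF, fun _ ↦ rfl⟩,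
      fun z _ hz ↦ absurd hz (h z).1, ?_⟩
    ext z
    rw [mem_filter_univ, ← hone]
    exact ((intCast_units_eq_sign_iff (h z).1 _).1 (h z).2).symm

lemma numPTF_eq_card_posSets (n d : ℕ) :
    numPTF n d = #(posSets (polySpace (Fin n) d) univ) := by
  rw [numPTF, ← Nat.subtype_card _ fun _ ↦ Iff.rfl]
  exact (Nat.card_congr ((signEquiv _).subtypeEquiv fun _ ↦ mem_posSets_polySpace_iff)).symm

theorem numPTF_le_sum_choose (n d : ℕ) :
    numPTF n d ≤ ∑ i ∈ Iic (∑ i ∈ range (d + 1), n.choose i), (2 ^ n).choose i := by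
  have hrank : finrank ℝ (polySpace (Fin n) d) ≤ ∑ i ∈ range (d + 1), n.choose i := by
    simpa using finrank_polySpace_le (Fin n) d
  rw [numPTF_eq_card_posSets]
  exact (card_posSets_le_sum_choose _ _).trans
    (by simpa using sum_le_sum_of_subset (Iic_subset_Iic.2 hrank))

lemma numPTF_le_two_pow (n d : ℕ) : numPTF n d ≤ 2 ^ 2 ^ n := by
  simpa [numPTF] using Nat.card_le_card_of_injective _ (Subtype.val_injective (p :=
    IsPolynomialThreshold n d))

lemma two_le_numPTF (n d : ℕ) : 2 ≤ numPTF n d := by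
  have hconst (u : ℤˣ) : IsPolynomialThreshold n d fun _ ↦ u := by
    have hu : ((u : ℤ) : ℝ) ≠ 0 := by simp
    refine ⟨MvPolynomial.C ((u : ℤ) : ℝ),
      (MvPolynomial.totalDegree_C _).trans_le d.zero_le, fun z ↦ ?_⟩
    rw [MvPolynomial.eval_C, intCast_units_eq_sign_iff hu, intCast_units_eq_ite]
    split_ifs with h <;> simp [h]
  calc 2 = Nat.card ℤˣ := by simp
    _ ≤ numPTF n d := Nat.card_le_card_of_injective
      (fun u ↦ (⟨fun _ ↦ u, hconst u⟩ : {f // IsPolynomialThreshold n d f}))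
      fun u v huv ↦ congrFun (Subtype.mk.inj huv) 1

theorem two_pow_le_mul_numPTF {m n₂ k s : ℕ} (hd : 1 ≤ d) (hk : 1 ≤ k)
    (hkm : k ≤ ∑ i ∈ range (d + 1), m.choose i) (hs : 4 ^ (m + 2 + n₂) ≤ s ^ n₂) :
    2 ^ ((m + n₂) * k) ≤ 2 * ((k ^ s * 2 ^ s * 2 ^ n₂) ^ k * numPTF (m + 1 + n₂) d) := by
  let e : (Fin (m + 1 + n₂) → ℤˣ) ≃ Finset (Fin (m + 1)) × Finset (Fin n₂) :=
    (((signEquiv _).prodCongr (signEquiv _)).trans (Fin.appendEquiv (m + 1) n₂)).symm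
  have he₁ (z i) : i ∈ (e z).1 ↔ z (Fin.castAdd n₂ i) = 1 := mem_signEquiv_symm
  have he₂ (z j) : j ∈ (e z).2 ↔ z (Fin.natAdd (m + 1) j) = 1 := mem_signEquiv_symm
  have hQ₁ (B : Finset (Fin (m + 1))) (hB : #B < d + 1) :
      (fun z ↦ if B ⊆ (e z).1 then 1 else 0) ∈ polySpace (Fin (m + 1 + n₂)) d := by
    simpa [subset_iff, he₁] using indicator_mem_polySpace (B := B.map (Fin.castAddEmb n₂))
      (d := d) (by simpa [Nat.lt_succ_iff] using hB)
  have hQ₂ (j : Fin n₂) :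
      (fun z ↦ if j ∈ (e z).2 then 1 else 0) ∈ polySpace (Fin (m + 1 + n₂)) d := by
    simpa [he₂] using indicator_mem_polySpace (B := {Fin.natAdd (m + 1) j}) (d := d) (by simpa)
  have hcount := two_pow_le_mul_card_zeroSets hQ₁ hQ₂ (s := s) (m := m) (by lia) hk (by simp) hkm
    (by simpa using hs)
  rw [Fintype.card_fin] at hcount
  rw [numPTF_eq_card_posSets]
  exact hcount.trans
    (Nat.mul_le_mul_left 2 (Nat.mul_le_mul_left _ (card_zeroSets_le_card_posSets _ _)))

end NumPTF

/-! ### The upper bound -/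

lemma mul_descFactorial_succ_le {n d : ℕ} (hd : 2 ≤ d) (hdn : d + 3 ≤ n) :
    n * n.descFactorial (d + 1) ≤ (n + 1) * (n ^ d * (n - (d + 1))) := by
  induction d, hd using Nat.le_induction with
  | base =>
    obtain ⟨r, rfl⟩ := Nat.exists_eq_add_of_le' hdn
    simp only [Nat.descFactorial_succ, Nat.descFactorial_zero, Nat.reduceAdd, Nat.sub_zero,
      Nat.reduceSubDiff, Nat.add_succ_sub_one]
    nlinarith [sq_nonneg r]
  | succ d hd ih =>
    obtain ⟨r, rfl⟩ := Nat.exists_eq_add_of_le' hdn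
    have hstep : (r + 3) ^ 2 ≤ (r + (d + 1 + 3)) * (r + 2) := by nlinarith
    have hsub₁ : r + (d + 1 + 3) - (d + 1) = r + 3 := by omega
    have hsub₂ : r + (d + 1 + 3) - (d + 1 + 1) = r + 2 := by omega
    have ih := ih (by omega)
    rw [Nat.descFactorial_succ, hsub₂]
    rw [hsub₁] at ih ⊢
    generalize r + (d + 1 + 3) = n at *
    calc n * ((r + 3) * n.descFactorial (d + 1)) = (r + 3) * (n * n.descFactorial (d + 1)) := by
          ring
      _ ≤ (r + 3) * ((n + 1) * (n ^ d * (r + 3))) := Nat.mul_le_mul_left _ ih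
      _ = (n + 1) * n ^ d * (r + 3) ^ 2 := by ring
      _ ≤ (n + 1) * n ^ d * (n * (r + 2)) := Nat.mul_le_mul_left _ hstep
      _ = (n + 1) * (n ^ (d + 1) * (r + 2)) := by ring

lemma choose_succ_le {n d : ℕ} (hd : 2 ≤ d) (hdn : d + 3 ≤ n) :
    (n.choose (d + 1) : ℝ) ≤
      (n ^ (d + 1) / (d + 1).factorial - n ^ d / d.factorial) * (1 + 1 / n) := by
  have hn : (0 : ℝ) < n := by exact_mod_cast (by omega : 0 < n)
  have h : (n : ℝ) * n.descFactorial (d + 1) ≤ (n + 1) * (n ^ d * (n - (d + 1))) := by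
    have h' := mul_descFactorial_succ_le hd hdn
    rw [← @Nat.cast_le ℝ] at h'
    push_cast [Nat.cast_sub (by omega : d + 1 ≤ n)] at h'
    exact h'
  rw [Nat.descFactorial_eq_factorial_mul_choose, Nat.cast_mul] at h
  have hfac : ((d + 1).factorial : ℝ) = (d + 1) * d.factorial := by
    rw [Nat.factorial_succ]
    push_cast
    rfl
  calc (n.choose (d + 1) : ℝ)
      = n * ((d + 1).factorial * n.choose (d + 1)) / (n * (d + 1).factorial) := by field_simp
    _ ≤ (n + 1) * (n ^ d * (n - (d + 1))) / (n * (d + 1).factorial) := by gcongr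
    _ = (n ^ (d + 1) / (d + 1).factorial - n ^ d / d.factorial) * (1 + 1 / n) := by
      rw [hfac]
      field_simp
      ring

lemma sum_choose_le {n d : ℕ} (hd : 2 ≤ d) (hdn : d + 2 ≤ n) :
    ((∑ i ∈ range (d + 1), n.choose i : ℕ) : ℝ) ≤ 1 + n ^ d / d.factorial * (1 + 1 / n) := by
  induction d, hd using Nat.le_induction with
  | base =>
    have hn : (n : ℝ) ≠ 0 := by
      have : n ≠ 0 := by omega
      exact_mod_cast this
    refine le_of_eq ?_
    simp only [sum_range_succ, sum_range_zero, Nat.choose_zero_right, Nat.choose_one_right,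
      Nat.cast_add, Nat.cast_choose_two, Nat.cast_one, Nat.cast_zero, Nat.factorial_two,
      Nat.cast_ofNat]
    field_simp
    ring
  | succ d hd ih =>
    rw [sum_range_succ, Nat.cast_add]
    linarith [ih (by omega), choose_succ_le hd (n := n) (by omega)]

lemma sum_choose_le_exp {M N : ℕ} (hN : 0 < N) (hNM : N ≤ M) :
    ((∑ i ∈ Iic N, M.choose i : ℕ) : ℝ) ≤ (Real.exp 1 * M / N) ^ N := by
  have hM : (0 : ℝ) < M := by exact_mod_cast hN.trans_le hNM
  have : (0 : ℝ) < N := by exact_mod_cast hN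
  set x : ℝ := N / M
  have hx₀ : 0 < x := by positivity
  have hx₁ : x ≤ 1 := (div_le_one hM).2 (by exact_mod_cast hNM)
  rw [show Real.exp 1 * M / N = Real.exp 1 / x by simp only [x]; field_simp, div_pow,
    le_div_iff₀ (by positivity)]
  calc ((∑ i ∈ Iic N, M.choose i : ℕ) : ℝ) * x ^ N
      ≤ ∑ i ∈ Iic N, x ^ i * 1 ^ (M - i) * M.choose i := by
        rw [Nat.cast_sum, sum_mul]
        refine sum_le_sum fun i hi ↦ ?_
        rw [one_pow, mul_one, mul_comm]
        gcongr ?_ * _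
        exact pow_le_pow_of_le_one hx₀.le hx₁ (mem_Iic.1 hi)
    _ ≤ (x + 1) ^ M := by
        rw [add_pow]
        refine sum_le_sum_of_subset_of_nonneg (fun i hi ↦ ?_) fun i _ _ ↦ by positivity
        exact mem_range.2 (Nat.lt_succ_of_le ((mem_Iic.1 hi).trans hNM))
    _ ≤ Real.exp x ^ M := by
        gcongr
        exact Real.add_one_le_exp x
    _ = Real.exp 1 ^ N := by
        rw [← Real.exp_nat_mul, ← Real.exp_nat_mul, mul_div_cancel₀ _ hM.ne', mul_one]

lemma numPTF_pos (n d : ℕ) : (0 : ℝ) < numPTF n d := by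
  exact_mod_cast zero_lt_two.trans_le (two_le_numPTF n d)

lemma logb_numPTF_le_two_pow (n d : ℕ) : Real.logb 2 (numPTF n d) ≤ 2 ^ n := by
  rw [Real.logb_le_iff_le_rpow one_lt_two (numPTF_pos n d)]
  exact_mod_cast numPTF_le_two_pow n d

lemma sum_choose_two_pow_le {n t N : ℕ} (hNn : N ≤ 2 ^ n) (ht : Real.exp 1 * 2 ^ t ≤ N) :
    ((∑ i ∈ Iic N, (2 ^ n).choose i : ℕ) : ℝ) ≤ (2 ^ n / 2 ^ t) ^ N := by
  have hN : (0 : ℝ) < N := lt_of_lt_of_le (by positivity) ht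
  refine (sum_choose_le_exp (by exact_mod_cast hN) hNn).trans ?_
  refine pow_le_pow_left₀ (by positivity) ?_ _
  rw [div_le_div_iff₀ hN (by positivity)]
  calc Real.exp 1 * (2 ^ n : ℕ) * 2 ^ t = 2 ^ n * (Real.exp 1 * 2 ^ t) := by push_cast; ring
    _ ≤ 2 ^ n * N := by gcongr

lemma logb_numPTF_le_mul {n d t : ℕ} (hdn : d ≤ n)
    (ht : Real.exp 1 * 2 ^ t ≤ (∑ i ∈ range (d + 1), n.choose i : ℕ)) :
    Real.logb 2 (numPTF n d) ≤ (n - t) * (∑ i ∈ range (d + 1), n.choose i : ℕ) := by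
  have hN : ∑ i ∈ range (d + 1), n.choose i ≤ 2 ^ n := by
    rw [← Nat.sum_range_choose]
    exact sum_le_sum_of_subset (range_mono (by omega))
  rw [Real.logb_le_iff_le_rpow one_lt_two (numPTF_pos n d), Real.rpow_mul two_pos.le,
    Real.rpow_natCast, Real.rpow_sub two_pos, Real.rpow_natCast, Real.rpow_natCast]
  exact (Nat.cast_le.2 (numPTF_le_sum_choose n d)).trans (sum_choose_two_pow_le hN ht)

lemma logb_numPTF_lt_of_two_le {n d : ℕ} (hd : 2 ≤ d) (hdn : d + 2 ≤ n) :
    Real.logb 2 (numPTF n d) < n ^ (d + 1) / d.factorial := by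
  have hn : (4 : ℝ) ≤ n := by exact_mod_cast (by omega : 4 ≤ n)
  have hN : 1 + (n : ℝ) + n * (n - 1) / 2 ≤ (∑ i ∈ range (d + 1), n.choose i : ℕ) := by
    calc 1 + (n : ℝ) + n * (n - 1) / 2 = (∑ i ∈ range 3, n.choose i : ℕ) := by
          simp only [sum_range_succ, sum_range_zero, Nat.choose_zero_right, Nat.choose_one_right,
            Nat.cast_add, Nat.cast_choose_two, Nat.cast_one, zero_add]
      _ ≤ (∑ i ∈ range (d + 1), n.choose i : ℕ) := by
          exact_mod_cast sum_le_sum_of_subset (range_mono (by omega))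
  have hgain := logb_numPTF_le_mul (n := n) (d := d) (t := 2) (by omega) <| by
    refine le_trans ?_ hN
    nlinarith [Real.exp_one_lt_d9]
  have hNle := sum_choose_le hd hdn
  set a : ℝ := n ^ d / d.factorial with ha
  have ha' : (n : ℝ) - 2 < a := by
    have : n * (n : ℝ) ≤ (n + 1) * a := by
      have h : (n : ℝ) ≤ a * (1 + 1 / n) := by nlinarith
      calc n * (n : ℝ) ≤ n * (a * (1 + 1 / n)) := by gcongr
        _ = (n + 1) * a := by field_simp
    nlinarith
  calc Real.logb 2 (numPTF n d)
      ≤ (n - 2) * (∑ i ∈ range (d + 1), n.choose i : ℕ) := hgain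
    _ ≤ (n - 2) * (1 + a * (1 + 1 / n)) :=
        mul_le_mul_of_nonneg_left hNle (by linarith)
    _ = n * a + (n - 2 - a) - 2 * (a / n) := by field_simp; ring
    _ < n * a := by
        have : 0 < a / n := by positivity
        linarith
    _ = n ^ (d + 1) / d.factorial := by rw [ha]; ring

lemma logb_numPTF_one_lt {n : ℕ} (hn : 1 < n) : Real.logb 2 (numPTF n 1) < n ^ 2 := by
  have hN : ∑ i ∈ range (1 + 1), n.choose i = n + 1 := by
    simp only [sum_range_succ, sum_range_zero, Nat.choose_zero_right, Nat.choose_one_right]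
    omega
  rcases le_or_gt 5 n with h5 | h5
  · have hn5 : (5 : ℝ) ≤ n := by exact_mod_cast h5
    have hgain := logb_numPTF_le_mul (n := n) (d := 1) (t := 1) hn.le <| by
      rw [hN]
      push_cast
      linarith [Real.exp_one_lt_d9]
    rw [hN] at hgain
    push_cast at hgain
    linarith
  · have hlt : numPTF n 1 < 2 ^ n ^ 2 := by
      refine (numPTF_le_sum_choose n 1).trans_lt ?_
      rw [hN, ← Nat.range_succ_eq_Iic]
      interval_cases n <;> decide +kernel
    rw [Real.logb_lt_iff_lt_rpow one_lt_two (numPTF_pos n 1)]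
    exact_mod_cast hlt

lemma two_pow_mul_factorial_le {n : ℕ} (hn : 1 ≤ n) : 2 ^ n * n.factorial ≤ 2 * n ^ n := by
  induction n, hn using Nat.le_induction with
  | base => simp
  | succ n hn ih =>
    have hstep : 2 * n ^ n ≤ (n + 1) ^ n := by
      calc 2 * n ^ n = n ^ n + n * n ^ (n - 1) * 1 := by
            rw [mul_pow_sub_one (by omega : n ≠ 0), mul_one, two_mul]
        _ ≤ (n + 1) ^ n := pow_add_mul_le_add_pow n.zero_le (by omega) n
    calc 2 ^ (n + 1) * (n + 1).factorial = 2 * (n + 1) * (2 ^ n * n.factorial) := by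
          rw [Nat.factorial_succ]
          ring
      _ ≤ 2 * (n + 1) * (n + 1) ^ n := Nat.mul_le_mul_left _ (ih.trans hstep)
      _ = 2 * (n + 1) ^ (n + 1) := by ring

lemma two_pow_mul_le {n d : ℕ} (hn : 1 ≤ n) (hd : d = n ∨ d + 1 = n) :
    (n : ℝ) * 2 ^ n ≤ 2 * (n ^ (d + 1) / d.factorial) := by
  have h : (2 : ℝ) ^ n * n.factorial ≤ 2 * n ^ n := by exact_mod_cast two_pow_mul_factorial_le hn
  have heq : (n : ℝ) ^ (d + 1) / d.factorial = n * (n ^ n / n.factorial) := by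
    rcases hd with rfl | rfl
    · ring
    · rw [Nat.factorial_succ]
      push_cast
      field_simp
  calc (n : ℝ) * 2 ^ n ≤ n * (2 * n ^ n / n.factorial) := by
        gcongr
        rwa [le_div_iff₀ (by positivity)]
    _ = 2 * (n ^ (d + 1) / d.factorial) := by rw [heq]; ring

theorem logb_numPTF_lt {n d : ℕ} (hn : 1 < n) (hd : 1 ≤ d) (hdn : d ≤ n)
    (h22 : ¬(n = 2 ∧ d = 2)) : Real.logb 2 (numPTF n d) < n ^ (d + 1) / d.factorial := by
  obtain rfl | hd2 := hd.eq_or_lt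
  · simpa using logb_numPTF_one_lt hn
  by_cases hdn2 : d + 2 ≤ n
  · exact logb_numPTF_lt_of_two_le hd2 hdn2
  have hn3 : (3 : ℝ) ≤ n := by exact_mod_cast (by omega : 3 ≤ n)
  have hpow : (0 : ℝ) < 2 ^ n := by positivity
  refine (logb_numPTF_le_two_pow n d).trans_lt ?_
  nlinarith [two_pow_mul_le (n := n) (d := d) hn.le (by omega)]

theorem logb_numPTF_le {n d : ℕ} (hn : 1 < n) (hd : 1 ≤ d) (hdn : d ≤ n) :
    Real.logb 2 (numPTF n d) ≤ n ^ (d + 1) / d.factorial := by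
  by_cases h22 : n = 2 ∧ d = 2
  · obtain ⟨rfl, rfl⟩ := h22
    exact (logb_numPTF_le_two_pow 2 2).trans (by norm_num)
  · exact (logb_numPTF_lt hn hd hdn h22).le

/-! ### The lower bound -/

lemma mul_le_logb_numPTF {d m n₂ k s : ℕ} (hd : 1 ≤ d) (hk : 1 ≤ k)
    (hkm : k ≤ ∑ i ∈ range (d + 1), m.choose i) (hs : 4 ^ (m + 2 + n₂) ≤ s ^ n₂) :
    (k : ℝ) * (m - s * Real.logb 2 k - s - 1) ≤ Real.logb 2 (numPTF (m + 1 + n₂) d) := by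
  have hk₁ : (1 : ℝ) ≤ k := by exact_mod_cast hk
  have hT := numPTF_pos (m + 1 + n₂) d
  have h : (2 : ℝ) ^ ((m + n₂) * k) ≤
      2 * (((k : ℝ) ^ s * 2 ^ s * 2 ^ n₂) ^ k * numPTF (m + 1 + n₂) d) := by
    exact_mod_cast two_pow_le_mul_numPTF hd hk hkm hs
  have hlog := Real.logb_le_logb_of_le one_lt_two (by positivity) h
  rw [Real.logb_mul two_ne_zero (by positivity), Real.logb_mul (by positivity) hT.ne',
    Real.logb_pow, Real.logb_pow, Real.logb_mul (by positivity) (by positivity),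
    Real.logb_mul (by positivity) (by positivity), Real.logb_pow, Real.logb_pow, Real.logb_pow,
    Real.logb_self_eq_one one_lt_two] at hlog
  push_cast at hlog
  linarith

lemma pow_div_factorial_le_choose {m d : ℕ} {x : ℝ} (hx : 0 ≤ x) (hxm : x + d ≤ m + 1) :
    x ^ d / d.factorial ≤ m.choose d := by
  refine le_trans ?_ (Nat.pow_le_choose d m)
  have hdm : d ≤ m + 1 := by exact_mod_cast (le_add_of_nonneg_left hx).trans hxm
  gcongr
  rw [Nat.cast_sub hdm]
  push_cast
  linarith

lemma pow_div_factorial_mul_le_logb_numPTF {m n₂ s d : ℕ} {x : ℝ} (hd : 1 ≤ d) (hx : 0 < x)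
    (hs : 4 ^ (m + 2 + n₂) ≤ s ^ n₂) (hxd : x + d ≤ m + 1)
    (hxs : x + s * Real.logb 2 (m.choose d) + s + 1 ≤ m) :
    x ^ d / d.factorial * x ≤ Real.logb 2 (numPTF (m + 1 + n₂) d) := by
  have hdm : d < m + 1 := by exact_mod_cast (lt_add_of_pos_left (d : ℝ) hx).trans_le hxd
  have hk : m.choose d ≤ ∑ i ∈ range (d + 1), m.choose i :=
    single_le_sum (f := fun i ↦ m.choose i) (fun i _ ↦ Nat.zero_le _) (self_mem_range_succ d)
  calc x ^ d / d.factorial * x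
      ≤ m.choose d * (m - s * Real.logb 2 (m.choose d) - s - 1) := by
        gcongr
        · exact pow_div_factorial_le_choose hx.le hxd
        · linarith
    _ ≤ _ := mul_le_logb_numPTF hd (Nat.choose_pos (Nat.le_of_lt_succ hdm)) hk hs

lemma logb_choose_le {m n : ℕ} (d : ℕ) (hmn : m ≤ n) (hn : 1 ≤ n) :
    Real.logb 2 (m.choose d) ≤ 1.5 * (d * Real.log n) := by
  have hn₁ : (1 : ℝ) ≤ n := by exact_mod_cast hn
  have : 0 ≤ Real.log n := Real.log_nonneg hn₁
  rcases (m.choose d).eq_zero_or_pos with h0 | hpos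
  · rw [h0, Nat.cast_zero, Real.logb_zero]
    positivity
  · have hle : (m.choose d : ℝ) ≤ n ^ d := by
      exact_mod_cast (Nat.choose_le_pow m d).trans (Nat.pow_le_pow_left hmn d)
    have hlog₂ := Real.log_two_gt_d9
    calc Real.logb 2 (m.choose d) ≤ Real.logb 2 (n ^ d) :=
          Real.logb_le_logb_of_le one_lt_two (by exact_mod_cast hpos) hle
      _ = d * Real.log n / Real.log 2 := by rw [Real.logb_pow, Real.logb, mul_div_assoc]
      _ ≤ 1.5 * (d * Real.log n) := by
          have : 0 ≤ d * Real.log n := by positivity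
          rw [div_le_iff₀ (by linarith)]
          nlinarith

lemma four_pow_succ_le_pow {n n₂ s : ℕ} {β : ℝ} (hn : 1 < n) (hs : (n : ℝ) ^ β ≤ s)
    (hn₂ : 4 * (n / Real.log n) ≤ β * n₂) : 4 ^ (n + 1) ≤ s ^ n₂ := by
  have hn₀ : (0 : ℝ) < n := by exact_mod_cast zero_lt_one.trans hn
  have hlog : 0 < Real.log n := Real.log_pos (by exact_mod_cast hn)
  have hexp : (2 : ℝ) ≤ Real.exp 1 := by linarith [Real.add_one_le_exp (1 : ℝ)]
  have h : (4 : ℝ) ^ (n + 1) ≤ s ^ n₂ :=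
    calc (4 : ℝ) ^ (n + 1) ≤ 4 ^ (2 * n) := pow_le_pow_right₀ (by norm_num) (by omega)
      _ = 2 ^ (4 * n) := by
          rw [show (4 : ℝ) = 2 ^ 2 by norm_num, ← pow_mul]
          ring_nf
      _ ≤ Real.exp 1 ^ (4 * n) := by gcongr
      _ = Real.exp (4 * (n / Real.log n) * Real.log n) := by
          rw [← Real.exp_nat_mul, mul_assoc, div_mul_cancel₀ _ hlog.ne']
          push_cast
          ring_nf
      _ ≤ Real.exp (β * n₂ * Real.log n) := by gcongr
      _ = ((n : ℝ) ^ β) ^ n₂ := by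
          rw [Real.rpow_def_of_pos hn₀, ← Real.exp_nat_mul]
          ring_nf
      _ ≤ s ^ n₂ := by gcongr
  exact_mod_cast h

lemma six_mul_rpow_le_div_log {n α β : ℝ} (hn : 1 < n) (hαβ : α + 2 * β = 1)
    (hlog : 6 * Real.log n ^ 2 ≤ n ^ β) :
    6 * (n ^ α * n ^ β * Real.log n) ≤ n / Real.log n := by
  have hn₀ : 0 < n := zero_lt_one.trans hn
  rw [le_div_iff₀ (Real.log_pos hn)]
  calc 6 * (n ^ α * n ^ β * Real.log n) * Real.log n = n ^ α * n ^ β * (6 * Real.log n ^ 2) := by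
        ring
    _ ≤ n ^ α * n ^ β * n ^ β := by gcongr
    _ = n := by
        rw [← Real.rpow_add hn₀, ← Real.rpow_add hn₀, add_assoc, ← two_mul, hαβ, Real.rpow_one]

lemma mul_add_le_of_six_mul_le {L r s u w y : ℝ} (hL : 3 ≤ L) (hu : 1 ≤ u) (hw : 1 ≤ w)
    (hr : 6 * (w * u * L) ≤ r) (hs : s ≤ u + 1) (hy : 0 ≤ y) (hyL : y ≤ 1.5 * (w * L)) :
    s * y + s + w + 4 ≤ r := by
  have hwP : w * 3 ≤ w * u * L := by
    rw [mul_assoc]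
    gcongr
    nlinarith
  have huP : u * 3 ≤ w * u * L := by
    rw [mul_comm w, mul_assoc]
    gcongr
    nlinarith
  have hsy : s * y ≤ 3 * (w * u * L) :=
    calc s * y ≤ (2 * u) * (1.5 * (w * L)) := by gcongr; linarith
      _ = 3 * (w * u * L) := by ring
  linarith

lemma exists_eq_add_of_lt_self {n : ℕ} {β : ℝ} (hn : 1 < n) (hβ : 0 < β)
    (hlt : 4 / β * (n / Real.log n) + 1 < n) :
    ∃ m n₂ s : ℕ, n = m + 1 + n₂ ∧ 4 ^ (m + 2 + n₂) ≤ s ^ n₂ ∧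
      n - 4 / β * (n / Real.log n) ≤ m + 2 ∧ s ≤ (n : ℝ) ^ β + 1 := by
  set n₂ := ⌈4 / β * (n / Real.log n)⌉₊
  have hlog : 0 < Real.log n := Real.log_pos (by exact_mod_cast hn)
  have hn₂ : (n₂ : ℝ) < 4 / β * (n / Real.log n) + 1 := Nat.ceil_lt_add_one (by positivity)
  have hn₂n : n₂ < n := by exact_mod_cast hn₂.trans hlt
  obtain ⟨m, hm⟩ : ∃ m, n = m + 1 + n₂ := ⟨n - n₂ - 1, by omega⟩
  refine ⟨m, n₂, ⌈(n : ℝ) ^ β⌉₊, hm, ?_, ?_, (Nat.ceil_lt_add_one (by positivity)).le⟩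
  · rw [show m + 2 + n₂ = n + 1 by omega]
    refine four_pow_succ_le_pow hn (Nat.le_ceil _) ?_
    rw [mul_comm β, ← div_le_iff₀ hβ, mul_div_right_comm]
    exact Nat.le_ceil _
  · have hmn : (n : ℝ) = m + 1 + n₂ := by exact_mod_cast hm
    linarith

lemma one_sub_pow_mul_le_logb_numPTF {α β : ℝ} (hβ : 0 < β) (hαβ : α + 2 * β = 1) {n d : ℕ}
    (hd : 1 ≤ d) (hdn : (d : ℝ) ≤ (n : ℝ) ^ α) (hL : 4 / β + 3 ≤ Real.log n)
    (hlog : 6 * Real.log n ^ 2 ≤ (n : ℝ) ^ β) :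
    (1 - (4 / β + 1) / Real.log n) ^ (d + 1) * ((n : ℝ) ^ (d + 1) / d.factorial) ≤
      Real.logb 2 (numPTF n d) := by
  have hK : 0 < 4 / β := by positivity
  have hn : (1 : ℝ) < n := (Real.log_pos_iff n.cast_nonneg).1 (by linarith)
  have hw : 1 ≤ (n : ℝ) ^ α := le_trans (by exact_mod_cast hd) hdn
  have herr {s y : ℝ} (hs : s ≤ (n : ℝ) ^ β + 1) (hy : 0 ≤ y)
      (hyL : y ≤ 1.5 * ((n : ℝ) ^ α * Real.log n)) :
      s * y + s + (n : ℝ) ^ α + 4 ≤ n / Real.log n :=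
    mul_add_le_of_six_mul_le (by linarith) (by nlinarith) hw
      (six_mul_rpow_le_div_log hn hαβ hlog) hs hy hyL
  have hr : (n : ℝ) ^ α + 4 ≤ n / Real.log n := by
    simpa using herr (s := 0) (by positivity) le_rfl (by positivity)
  have hLn : (4 / β + 3) * (n / Real.log n) ≤ n :=
    calc (4 / β + 3) * (n / Real.log n) ≤ Real.log n * (n / Real.log n) := by gcongr
      _ = n := mul_div_cancel₀ _ (by linarith)
  obtain ⟨m, n₂, s, hm, hLO, hmn, hs⟩ :=
    exists_eq_add_of_lt_self (by exact_mod_cast hn) hβ (by linarith)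
  set k := m.choose d
  have hk : Real.logb 2 k ≤ 1.5 * ((n : ℝ) ^ α * Real.log n) :=
    (logb_choose_le (n := n) d (by omega) (by omega)).trans (by gcongr)
  have hk₀ : 0 ≤ Real.logb 2 k := div_nonneg (Real.log_natCast_nonneg k) (by positivity)
  have hsk := herr hs hk₀ hk
  set x := n * (1 - (4 / β + 1) / Real.log n) with hx
  have hx' : x = n - 4 / β * (n / Real.log n) - n / Real.log n := by ring
  calc (1 - (4 / β + 1) / Real.log n) ^ (d + 1) * ((n : ℝ) ^ (d + 1) / d.factorial)
      = x ^ d / d.factorial * x := by rw [hx, mul_pow]; ring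
    _ ≤ Real.logb 2 (numPTF (m + 1 + n₂) d) :=
        pow_div_factorial_mul_le_logb_numPTF hd (by linarith) hLO (by linarith) (by linarith)
    _ = Real.logb 2 (numPTF n d) := by rw [hm]

lemma eventually_six_mul_sq_log_le {β : ℝ} (hβ : 0 < β) :
    ∀ᶠ n : ℕ in atTop, 6 * Real.log n ^ 2 ≤ (n : ℝ) ^ β := by
  have h := (isLittleO_log_rpow_rpow_atTop 2 hβ).bound (show (0 : ℝ) < 1 / 6 by norm_num)
  filter_upwards [tendsto_natCast_atTop_atTop.eventually h] with n hn
  rw [Real.rpow_two, Real.norm_of_nonneg (by positivity), Real.norm_of_nonneg (by positivity)] at hn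
  linarith

lemma eventually_one_sub_pow_mul_le_logb_numPTF {α : ℝ} (hα : α < 1) :
    ∃ c > 0, ∀ᶠ n : ℕ in atTop, ∀ d : ℕ, 1 ≤ d → (d : ℝ) ≤ (n : ℝ) ^ α →
      (1 - c / Real.log n) ^ (d + 1) * ((n : ℝ) ^ (d + 1) / d.factorial) ≤
        Real.logb 2 (numPTF n d) := by
  have hβ : 0 < (1 - α) / 2 := by linarith
  refine ⟨4 / ((1 - α) / 2) + 1, by positivity, ?_⟩
  have hlog := Real.tendsto_log_atTop.comp (tendsto_natCast_atTop_atTop (R := ℝ))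
  filter_upwards [eventually_six_mul_sq_log_le hβ,
    hlog.eventually_ge_atTop (4 / ((1 - α) / 2) + 3)] with n hn hL d hd hdn
  exact one_sub_pow_mul_le_logb_numPTF hβ (by ring) hd hdn hL hn

lemma one_sub_two_mul_pow_lt {x y : ℝ} {d : ℕ} (hd : 1 ≤ d) (hx : 0 < x) (hxy : 2 * x ≤ y)
    (hy : y < 1) : (1 - y) ^ d < (1 - x) ^ (d + 1) :=
  calc (1 - y) ^ d < ((1 - x) ^ 2) ^ d :=
        pow_lt_pow_left₀ (by nlinarith) (by linarith) (by omega)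
    _ = (1 - x) ^ (2 * d) := by rw [pow_mul]
    _ ≤ (1 - x) ^ (d + 1) := pow_le_pow_of_le_one (by linarith) (by linarith) (by omega)

theorem exists_max_pow_mul_lt_logb_numPTF {α : ℝ} (hα : α < 1) :
    ∃ C : ℝ, 0 < C ∧ ∀ n d : ℕ, 1 < n → 1 ≤ d → (d : ℝ) ≤ (n : ℝ) ^ α →
      (max 0 (1 - C / Real.log n)) ^ d * ((n : ℝ) ^ (d + 1) / d.factorial) <
        Real.logb 2 (numPTF n d) := by
  obtain ⟨c, hc, h⟩ := eventually_one_sub_pow_mul_le_logb_numPTF hα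
  obtain ⟨n₀, hn₀⟩ := eventually_atTop.1 h
  refine ⟨max (2 * c) (Real.log n₀), lt_max_of_lt_left (by positivity), fun n d hn hd hdn ↦ ?_⟩
  set C := max (2 * c) (Real.log n₀)
  have hlog : 0 < Real.log n := Real.log_pos (by exact_mod_cast hn)
  rcases le_or_gt 1 (C / Real.log n) with hC | hC
  · rw [max_eq_left (by linarith), zero_pow (by omega), zero_mul]
    exact Real.logb_pos one_lt_two (by exact_mod_cast two_le_numPTF n d)
  · have hn₀n : n₀ ≤ n := by
      by_contra! hlt
      refine ((div_lt_one hlog).1 hC).not_ge ?_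
      calc Real.log n ≤ Real.log n₀ := by gcongr
        _ ≤ C := le_max_right _ _
    have hcC : 2 * (c / Real.log n) ≤ C / Real.log n := by
      rw [← mul_div_assoc]
      gcongr
      exact le_max_left _ _
    rw [max_eq_right (by linarith)]
    refine lt_of_lt_of_le ?_ (hn₀ n hn₀n d hd hdn)
    gcongr
    exact one_sub_two_mul_pow_lt hd (by positivity) hcC hC

end PTF

theorem corollary1p2_general {α : ℝ} (hα : α < 1) :
    (∃ C : ℝ, 0 < C ∧ ∀ n d : ℕ, 1 < n → 1 ≤ d → (d : ℝ) ≤ (n : ℝ) ^ α →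
      (max 0 (1 - C / Real.log (n : ℝ))) ^ d * ((n : ℝ) ^ (d + 1) / (Nat.factorial d : ℝ))
          < Real.logb 2 (numPTF n d : ℝ) ∧
        Real.logb 2 (numPTF n d : ℝ) < (n : ℝ) ^ (d + 1) / (Nat.factorial d : ℝ)) ∧
    (∀ n d : ℕ, 1 < n → 1 ≤ d → d ≤ n →
      Real.logb 2 (numPTF n d : ℝ) ≤ (n : ℝ) ^ (d + 1) / (Nat.factorial d : ℝ) ∧
        (¬(n = 2 ∧ d = 2) →
          Real.logb 2 (numPTF n d : ℝ) < (n : ℝ) ^ (d + 1) / (Nat.factorial d : ℝ))) := by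
  refine ⟨?_, fun n d hn hd hdn ↦
    ⟨PTF.logb_numPTF_le hn hd hdn, PTF.logb_numPTF_lt hn hd hdn⟩⟩
  obtain ⟨C, hC, hlower⟩ := PTF.exists_max_pow_mul_lt_logb_numPTF hα
  refine ⟨C, hC, fun n d hn hd hdn ↦ ⟨hlower n d hn hd hdn, ?_⟩⟩
  have hlt : d < n := by
    have : (n : ℝ) ^ α < n := Real.rpow_lt_self_of_one_lt (by exact_mod_cast hn) hα
    exact_mod_cast hdn.trans_lt this
  exact PTF.logb_numPTF_lt hn hd hlt.le (by omega)

theorem corollary1p2 :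
    (∃ C : ℝ, 0 < C ∧ ∀ n d : ℕ, 1 < n → 1 ≤ d → (d : ℝ) ≤ (n : ℝ) ^ (0.9 : ℝ) →
      (max 0 (1 - C / Real.log (n : ℝ))) ^ d * ((n : ℝ) ^ (d + 1) / (Nat.factorial d : ℝ))
          < Real.logb 2 (numPTF n d : ℝ) ∧
        Real.logb 2 (numPTF n d : ℝ) < (n : ℝ) ^ (d + 1) / (Nat.factorial d : ℝ)) ∧
    (∀ n d : ℕ, 1 < n → 1 ≤ d → d ≤ n →
      Real.logb 2 (numPTF n d : ℝ) ≤ (n : ℝ) ^ (d + 1) / (Nat.factorial d : ℝ) ∧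
        (¬(n = 2 ∧ d = 2) →
          Real.logb 2 (numPTF n d : ℝ) < (n : ℝ) ^ (d + 1) / (Nat.factorial d : ℝ))) :=
  corollary1p2_general (by norm_num)
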